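/- **Setting.** Fix integers $L\ge 1$, $d\ge 1$, $m\ge 0$ and real polynomials $\phi^{(1)},\dots,\phi^{(L)}$. For each width $n$, consider the fully-connected network with $L$ hidden layers of width $n$, $$x^{(1)}=\phi^{(1)}\big(d^{-1/2}Ux\big),\qquad x^{(\ell)}=\phi^{(\ell)}\big(n^{-1/2}W^{(\ell)}x^{(\ell-1)}\big)\ (2\le \ell\le L),\qquad f_\theta(x)=n^{-1/2}V^{T}x^{(L)},$$ where the $\phi^{(\ell)}$ act entrywise, $x\in\mathbb R^d$, and the parameters $\theta=(U,W^{(2)},\dots,W^{(L)},V)$, with $U\in\mathbb R^{n\times d}$, $W^{(\ell)}\in\mathbb R^{n\times n}$, $V\in\mathbb R^n$, are i.i.d. $\mathcal N(0,1)$. Let $$\mathcal F(x_1,\dots,x_m)=\sum_{\text{indices}}\partial^{k_1}f_\theta(x_1)\cdots\partial^{k_m}f_\theta(x_m)$$ be a product of derivative tensors, where $\partial^k f_\theta(x)$ is the tensor of $k$-th partial derivatives of $f_\theta(x)$ with respect to the parameters, all tensor indices are partitioned into pairs (the partition and the ranks $k_1,\dots,k_m\ge 0$ do not depend on $n$; a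 pair may lie within one tensor), the two indices of a pair are set equal, and each is summed over all network parameters. The correlation function is $C(x_1,\dots,x_m)=\mathbb E_\theta[\mathcal F(x_1,\dots,x_m)]$. Its cluster graph has the $m$ derivative tensors as vertices, with an edge between two distinct tensors if some index of one is paired with some index of the other. Let $n_e$ (respectively $n_o$) be the number of its connected components with an even (respectively odd) number of vertices, and put $s_C=n_e+(n_o-m)/2$. **Corollary.** For fixed inputs $x_1,\dots,x_m\in\mathbb R^d$, the random variable $\mathcal F(x_1,\dots,x_m)$ is square-integrable for every $n$, and as $n\to\infty$, $C(x_1,\dots,x_m)=\mathcal O(n^{s_C})$ and $$\operatorname{Var}_\theta\big[\mathcal F(x_1,\dots,x_m)\big]=\mathcal O(n^{s_V}),\qquad s_V=\begin{cases}2s_C-1 & \text{if } n_o=0,\\ 2s_C & \text{if } n_o\neq 0.\end{cases}$$ If $n_o=0$, this is strictly tighter than the bound $\mathcal O(n^{2s_C})$ of Dyer and Gur-Ari: $n^{s_V}=o(n^{2s_C})$. -/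

import Mathlib

open scoped Polynomial
open Asymptotics Filter MeasureTheory ProbabilityTheory

namespace WideNet

/-- Indices of the parameters of a fully-connected network with `L + 1` hidden layers of width `n`
(so at least one hidden layer) and input dimension `d`:
* `U i α`, the entries of the `n × d` input matrix;
* `W ℓ i j`, for `ℓ : Fin L`, the entries of the `n × n` matrix from hidden layer `ℓ + 1` to hidden
  layer `ℓ + 2` (counting hidden layers from `1`);
* `V i`, the entries of the output vector. -/
abbrev Param (L d n : ℕ) : Type :=
  (Fin n × Fin d) ⊕ (Fin L × Fin n × Fin n) ⊕ Fin n

/-- The index of the entry `U i α`. -/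
abbrev Param.U {L d n : ℕ} (i : Fin n) (α : Fin d) : Param L d n := Sum.inl (i, α)

/-- The index of the entry `W ℓ i j`. -/
abbrev Param.W {L d n : ℕ} (ℓ : Fin L) (i j : Fin n) : Param L d n :=
  Sum.inr (Sum.inl (ℓ, i, j))

/-- The index of the entry `V i`. -/
abbrev Param.V {L d n : ℕ} (i : Fin n) : Param L d n := Sum.inr (Sum.inr i)

/-- Post-activations of the hidden layers (layer `ℓ : Fin (L + 1)` counted from `0`):
`x⁽¹⁾ = φ⁽¹⁾(d^{-1/2} U x)` and `x⁽ˡ⁾ = φ⁽ˡ⁾(n^{-1/2} W⁽ˡ⁾ x⁽ˡ⁻¹⁾)`. -/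
noncomputable def postAct {L d n : ℕ} (φ : Fin (L + 1) → ℝ[X]) (x : Fin d → ℝ)
    (θ : Param L d n → ℝ) : Fin (L + 1) → Fin n → ℝ :=
  Fin.induction (motive := fun _ => Fin n → ℝ)
    (fun i => (φ 0).eval ((√(d : ℝ))⁻¹ * ∑ α, θ (Param.U i α) * x α))
    (fun ℓ prev i => (φ ℓ.succ).eval ((√(n : ℝ))⁻¹ * ∑ j, θ (Param.W ℓ i j) * prev j))

/-- The network function `f_θ(x) = n^{-1/2} Vᵀ x⁽ᴸ⁾`, where `x⁽ᴸ⁾` is the last hidden layer. -/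
noncomputable def net {L d : ℕ} (n : ℕ) (φ : Fin (L + 1) → ℝ[X]) (x : Fin d → ℝ)
    (θ : Param L d n → ℝ) : ℝ :=
  (√(n : ℝ))⁻¹ * ∑ i, θ (Param.V i) * postAct φ x θ (Fin.last L) i

/-- The law of the parameters at initialization: i.i.d. standard Gaussians. -/
noncomputable def initLaw (L d n : ℕ) : Measure (Param L d n → ℝ) :=
  Measure.pi fun _ => gaussianReal 0 1

/-- The component `∂ᵏ g / ∂θ^{μ 0} ⋯ ∂θ^{μ (k-1)}` of the rank-`k` derivative tensor of `g`. -/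
noncomputable def derivTensor {ι : Type} [Fintype ι] [DecidableEq ι] (g : (ι → ℝ) → ℝ) {k : ℕ}
    (μ : Fin k → ι) (θ : ι → ℝ) : ℝ :=
  iteratedFDeriv ℝ k g θ fun j => Pi.single (μ j) 1

/-- The derivative structure of a product of `m` derivative tensors whose indices are summed in
pairs. The `I`-th tensor has rank `rank I`, the tensor indices are the pairs `⟨I, a⟩` with
`a : Fin (rank I)`, and `slot` is a partition of all of them into `pairs` pairs: `⟨I, a⟩` and
`⟨J, b⟩` are summed together when their images have the same first component. -/
structure Contraction (m : ℕ) where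
  rank : Fin m → ℕ
  pairs : ℕ
  slot : ((I : Fin m) × Fin (rank I)) ≃ Fin pairs × Fin 2

namespace Contraction

variable {m : ℕ} (c : Contraction m)

/-- The product `𝓕(x₁, …, x_m) = ∑_{indices} ∂^{k₁} f_θ(x₁) ⋯ ∂^{k_m} f_θ(x_m)` of derivative
tensors, a function of the parameters `θ`; each pair of indices carries one summation index that
runs over all network parameters. -/
noncomputable def tensorProd {L d : ℕ} (n : ℕ) (φ : Fin (L + 1) → ℝ[X])
    (x : Fin m → Fin d → ℝ) (θ : Param L d n → ℝ) : ℝ :=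
  ∑ μ : Fin c.pairs → Param L d n,
    ∏ I, derivTensor (net n φ (x I)) (fun a => μ (c.slot ⟨I, a⟩).1) θ

/-- The correlation function `C(x₁, …, x_m) = 𝔼_θ[𝓕(x₁, …, x_m)]` at width `n`. -/
noncomputable def correlation {L d : ℕ} (n : ℕ) (φ : Fin (L + 1) → ℝ[X])
    (x : Fin m → Fin d → ℝ) : ℝ :=
  ∫ θ, c.tensorProd n φ x θ ∂(initLaw L d n)

/-- The cluster graph: its vertices are the `m` derivative tensors, and two distinct ones are
adjacent when some index of the first is summed together with some index of the second. -/
def clusterGraph : SimpleGraph (Fin m) :=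
  SimpleGraph.fromRel fun I J => ∃ a b, (c.slot ⟨I, a⟩).1 = (c.slot ⟨J, b⟩).1

/-- The number of components of the cluster graph with an even number of vertices. -/
noncomputable def numEven : ℕ :=
  {K : c.clusterGraph.ConnectedComponent | Even K.supp.ncard}.ncard

/-- The number of components of the cluster graph with an odd number of vertices. -/
noncomputable def numOdd : ℕ :=
  {K : c.clusterGraph.ConnectedComponent | Odd K.supp.ncard}.ncard

/-- The scaling exponent `s_C = n_e + (n_o - m) / 2`. -/
noncomputable def sC : ℝ := c.numEven + ((c.numOdd : ℝ) - m) / 2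

/-- The variance exponent `s_V`: `2 s_C - 1` if `n_o = 0`, and `2 s_C` otherwise. -/
noncomputable def sV : ℝ := if c.numOdd = 0 then 2 * c.sC - 1 else 2 * c.sC

end Contraction

end WideNet

/-! Since the activations are polynomials, the network function is a finite, width-independent
linear combination of connected diagrams. Each diagram is a sum, over assignments of the width
indices, of a product of parameters: some input weights, `w` hidden weights and exactly one output
weight, with prefactor `n^{-(w+1)/2}` (`exists_net_eq`). Differentiating removes factors, and
summing paired tensor indices forces the removed factors to carry equal labels. Hence the tensor
product is a finite combination of amplitudes with prefactor `n^{-(w+m)/2}`, where `w` now counts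
the hidden weights of all `m` diagrams (`exists_tensorProd_eq`).

The mean is then a count. A Gaussian moment vanishes unless every parameter occurs an even number of
times, so each contributing assignment is compatible with a fixed-point-free pairing of all the
factors that extends the contractions. There are boundedly many pairings. For a fixed one, glue the
width indices that it identifies: this gives a graph with at most `w/2` edges, one per pair of
hidden weights, so it has at most `w/2` more vertices than components, and an assignment is a choice
of one value per vertex (`card_solutions_le`). Each component contains evenly many diagrams, because
output weights are paired with output weights, and it is a union of clusters, because contracted
factors are paired. So there are at most `n_e + n_o/2` components (`two_mul_card_le_sum`), and the
powers of `n` add up to `s_C`.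

For the variance the same count is made on two copies of the diagram. A covariance of two monomials
vanishes unless they share a parameter, so the pairing may be chosen to join the copies
(`even_of_covariance_ne_zero`, `exists_isPairing_of_eq`). If every cluster is even, this link costs
at least one of the `2 n_e` possible components, hence one factor of `n`. If there are odd clusters,
only the doubled count `2 n_e + n_o` is used, and nothing is gained. -/

namespace WideNet

/-- Parameter labels whose width indices range over an arbitrary type `A`; `Param L d n` is the case
`A = Fin n`. -/
abbrev PIdx (L d : ℕ) (A : Type) : Type := (A × Fin d) ⊕ (Fin L × A × A) ⊕ A

namespace PIdx

variable {L d : ℕ} {A B C : Type}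

/-- Relabel the width indices. -/
def map (a : A → B) : PIdx L d A → PIdx L d B :=
  Sum.map (Prod.map a id) (Sum.map (Prod.map id (Prod.map a a)) a)

/-- The first width index of a label. -/
def fst : PIdx L d A → A
  | .inl (u, _) => u
  | .inr (.inl (_, u, _)) => u
  | .inr (.inr u) => u

/-- The last width index of a label. -/
def snd : PIdx L d A → A
  | .inl (u, _) => u
  | .inr (.inl (_, _, v)) => v
  | .inr (.inr u) => u

/-- Whether the label is that of a hidden weight matrix. -/
def isW : PIdx L d A → Bool
  | .inr (.inl _) => true
  | _ => false

/-- Whether the label is that of an output weight. -/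
def isV : PIdx L d A → Bool
  | .inr (.inr _) => true
  | _ => false

@[simp] theorem fst_map (a : A → B) (p : PIdx L d A) : (p.map a).fst = a p.fst := by
  rcases p with ⟨u, α⟩ | ⟨ℓ, u, v⟩ | u <;> rfl

@[simp] theorem snd_map (a : A → B) (p : PIdx L d A) : (p.map a).snd = a p.snd := by
  rcases p with ⟨u, α⟩ | ⟨ℓ, u, v⟩ | u <;> rfl

@[simp] theorem isW_map (a : A → B) (p : PIdx L d A) : (p.map a).isW = p.isW := by
  rcases p with ⟨u, α⟩ | ⟨ℓ, u, v⟩ | u <;> rfl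

@[simp] theorem isV_map (a : A → B) (p : PIdx L d A) : (p.map a).isV = p.isV := by
  rcases p with ⟨u, α⟩ | ⟨ℓ, u, v⟩ | u <;> rfl

theorem map_map (b : B → C) (a : A → B) (p : PIdx L d A) :
    (p.map a).map b = p.map (b ∘ a) := by
  rcases p with ⟨u, α⟩ | ⟨ℓ, u, v⟩ | u <;> rfl

end PIdx

/-! ### Pairings within fibres, identifications, and parity counts. -/

section Combinatorics

open Finset

/-- A family all of whose fibres over `S` are even can be paired up within the fibres. -/
theorem exists_perm_of_even_fibers {E X : Type*} [DecidableEq E] [DecidableEq X] (g : E → X)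
    (S : Finset E) (h : ∀ x, Even #{e ∈ S | g e = x}) :
    ∃ P : Equiv.Perm E, (∀ e, P (P e) = e) ∧ (∀ e, g (P e) = g e) ∧ (∀ e ∈ S, P e ≠ e) ∧
      ∀ e, e ∉ S → P e = e := by
  induction S using Finset.strongInduction with
  | H S ih =>
    rcases S.eq_empty_or_nonempty with rfl | ⟨e, he⟩
    · exact ⟨1, by simp⟩
    -- The fibre of `e` is nonempty and even, so it has a second element `e'`. Removing both keeps
    -- all fibres even; the pairing of what is left fixes both, and is completed by the swap.
    have h1 : 1 < #{z ∈ S | g z = g e} := by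
      have hpos : 0 < #{z ∈ S | g z = g e} := card_pos.2 ⟨e, by simp [he]⟩
      obtain ⟨k, hk⟩ := h (g e)
      omega
    obtain ⟨e', he', hne⟩ := exists_mem_ne h1 e
    rw [mem_filter] at he'
    obtain ⟨he'S, hge⟩ := he'
    have hmem : e' ∈ S.erase e := mem_erase.2 ⟨hne, he'S⟩
    obtain ⟨P, hP2, hPg, hPS, hPo⟩ := ih ((S.erase e).erase e')
      ((erase_subset _ _).trans_ssubset (erase_ssubset he)) (by
        intro x
        rw [filter_erase, filter_erase]
        by_cases hx : g e = x
        · have h2 : e ∈ {z ∈ S | g z = x} := by simp [he, hx]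
          have h3 : e' ∈ ({z ∈ S | g z = x}).erase e := by simp [he'S, hne, hge, hx]
          rw [card_erase_of_mem h3, card_erase_of_mem h2]
          obtain ⟨k, hk⟩ := h x
          exact ⟨k - 1, by omega⟩
        · have h2 : e ∉ {z ∈ S | g z = x} := by simp [hx]
          have h3 : e' ∉ {z ∈ S | g z = x} := by simp [hge, hx]
          rw [erase_eq_of_notMem h2, erase_eq_of_notMem h3]
          exact h x)
    have hPe : P e = e := hPo e (by simp)
    have hPe' : P e' = e' := hPo e' (by simp)
    have key : ∀ z, z ≠ e → z ≠ e' → (Equiv.swap e e' * P) z = P z := by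
      intro z h1 h2
      refine Equiv.swap_apply_of_ne_of_ne (fun h => h1 ?_) (fun h => h2 ?_)
      · exact P.injective (h.trans hPe.symm)
      · exact P.injective (h.trans hPe'.symm)
    have ke : (Equiv.swap e e' * P) e = e' := by simp [hPe]
    have ke' : (Equiv.swap e e' * P) e' = e := by simp [hPe']
    refine ⟨Equiv.swap e e' * P, fun z => ?_, fun z => ?_, fun z hz => ?_, fun z hz => ?_⟩
    · by_cases h1 : z = e
      · rw [h1, ke, ke']
      by_cases h2 : z = e'
      · rw [h2, ke', ke]
      rw [key z h1 h2, key _ _ _, hP2]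
      · exact fun h => h1 (P.injective (h.trans hPe.symm))
      · exact fun h => h2 (P.injective (h.trans hPe'.symm))
    · by_cases h1 : z = e
      · rw [h1, ke, hge]
      by_cases h2 : z = e'
      · rw [h2, ke', hge]
      rw [key z h1 h2, hPg]
    · by_cases h1 : z = e
      · rw [h1, ke]; exact hne
      by_cases h2 : z = e'
      · rw [h2, ke']; exact hne.symm
      rw [key z h1 h2]
      exact hPS z (by simp [h1, h2, hz])
    · have h1 : z ≠ e := fun h => hz (h ▸ he)
      have h2 : z ≠ e' := fun h => hz (h ▸ he'S)
      rw [key z h1 h2]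
      exact hPo z (by simp [hz])

/-- Imposing `#S` identifications on a finite type lowers its cardinality by at most `#S`. -/
theorem exists_merge {Q : Type} [Fintype Q] [DecidableEq Q] (S : Finset (Q × Q)) :
    ∃ (R : Type) (_ : Fintype R) (π : Q → R), Function.Surjective π ∧
      (∀ p ∈ S, π p.1 = π p.2) ∧ Fintype.card Q ≤ #S + Fintype.card R := by
  classical
  induction S using Finset.induction_on with
  | empty => exact ⟨Q, inferInstance, id, Function.surjective_id, by simp, by simp⟩
  | insert p S hp ih =>
    obtain ⟨R, _, π, hsurj, hπ, hcard⟩ := ih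
    rw [card_insert_of_notMem hp]
    by_cases h12 : π p.1 = π p.2
    · refine ⟨R, inferInstance, π, hsurj, fun q hq => ?_, by omega⟩
      rcases mem_insert.1 hq with rfl | hq
      exacts [h12, hπ q hq]
    -- A new identification discards the class of `p.1` and sends it to that of `p.2`, losing
    -- exactly one class.
    refine ⟨{r // r ≠ π p.1}, inferInstance,
      fun q => if h : π q = π p.1 then ⟨π p.2, Ne.symm h12⟩ else ⟨π q, h⟩, ?_, ?_, ?_⟩
    · rintro ⟨r, hr⟩
      obtain ⟨q, rfl⟩ := hsurj r
      exact ⟨q, by simp [hr]⟩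
    · intro q hq
      rcases mem_insert.1 hq with rfl | hq
      · simp
      · simp [hπ q hq]
    · have : Fintype.card {r // r ≠ π p.1} = Fintype.card R - 1 := by
        simp [Fintype.card_subtype_compl]
      have hpos : 0 < Fintype.card R := Fintype.card_pos_iff.2 ⟨π p.1⟩
      omega

/-- The involution preserves each fibre of `ρ` and has no fixed point there; modulo 2 the ones
cancel in pairs. -/
theorem even_card_filter_of_involution {ι R : Type*} [Fintype ι] [DecidableEq R] (τ : ι → ι)
    (hτ : Function.Involutive τ) (hne : ∀ I, τ I ≠ I) (ρ : ι → R) (hρ : ∀ I, ρ (τ I) = ρ I)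
    (r : R) : Even #{I | ρ I = r} := by
  rw [← ZMod.natCast_eq_zero_iff_even, Finset.cast_card]
  refine Finset.sum_involution (fun I _ => τ I) (fun I _ => by decide) (fun I _ _ => hne I)
    (fun I hI => ?_) (fun I _ => hτ I)
  simpa [hρ] using hI

/-- A partition into even blocks that are unions of clusters has at most as many blocks as there
are even clusters and pairs of odd clusters. -/
theorem two_mul_card_le_sum {ι κ R : Type*} [Fintype ι] [Fintype κ] [Fintype R] [DecidableEq κ]
    [DecidableEq R] (cl : ι → κ) (ρ : κ → R) (hsurj : Function.Surjective (ρ ∘ cl))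
    (heven : ∀ r, Even #{I | ρ (cl I) = r}) :
    2 * Fintype.card R ≤ ∑ K, if Even #{I | cl I = K} then 2 else 1 := by
  rw [← Finset.sum_fiberwise (s := Finset.univ) (g := ρ), mul_comm, ← smul_eq_mul,
    ← Finset.card_univ, ← Finset.sum_const]
  refine Finset.sum_le_sum fun r _ => ?_
  obtain ⟨I, rfl⟩ := hsurj r
  have hK : cl I ∈ ({K | ρ K = (ρ ∘ cl) I} : Finset κ) := by simp
  -- Each block must collect weight at least 2. An even cluster supplies it alone; an odd one cannot
  -- fill an even block, so a second cluster contributes at least 1.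
  by_cases hE : Even #{J | cl J = cl I}
  · refine le_trans ?_ (Finset.single_le_sum (fun _ _ => Nat.zero_le _) hK)
    rw [if_pos hE]
  · obtain ⟨J, hJ, hJne⟩ : ∃ J, ρ (cl J) = ρ (cl I) ∧ cl J ≠ cl I := by
      by_contra! hcon
      refine hE ?_
      convert heven (ρ (cl I)) using 2
      ext J
      simp only [mem_filter, mem_univ, true_and]
      exact ⟨fun h => by rw [h], hcon J⟩
    have hsub : ({cl I, cl J} : Finset κ) ⊆ ({K | ρ K = (ρ ∘ cl) I} : Finset κ) := by
      intro K hK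
      rcases mem_insert.1 hK with rfl | hK
      · simp
      · rw [mem_singleton] at hK
        simp [hK, hJ]
    refine le_trans ?_ (Finset.sum_le_sum_of_subset hsub)
    rw [Finset.sum_pair hJne.symm]
    have : ∀ K : κ, 1 ≤ if Even #{I | cl I = K} then 2 else 1 := fun K => by split_ifs <;> simp
    exact Nat.add_le_add (this _) (this _)

end Combinatorics

/-! ### Diagrams and the count of compatible index assignments. -/

/-- A family of connected diagrams indexed by `ι`: width indices are the elements of `A`, and
each `e : E` stands for a factor `θ (lab e)` belonging to the diagram `own e`. Every diagram has
exactly one output weight. -/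
structure Diag (L d : ℕ) (ι : Type) where
  A : Type
  E : Type
  [fintypeA : Fintype A]
  [fintypeE : Fintype E]
  lab : E → PIdx L d A
  own : E → ι
  root : ι → A
  vfac : ι → E
  lab_vfac : ∀ I, lab (vfac I) = Sum.inr (Sum.inr (root I))
  own_vfac : ∀ I, own (vfac I) = I
  eq_vfac : ∀ e, (lab e).isV → e = vfac (own e)
  -- Connectedness is encoded by test functions: an `h` that is constant along hidden weights takes
  -- at every index the value at some root, and at every factor the value at the root of its own
  -- diagram.
  exists_root : ∀ (Z : Type) (h : A → Z), (∀ e, (lab e).isW → h (lab e).fst = h (lab e).snd) →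
    ∀ u, ∃ I, h u = h (root I)
  apply_fst_lab : ∀ (Z : Type) (h : A → Z), (∀ e, (lab e).isW → h (lab e).fst = h (lab e).snd) →
    ∀ e, h (lab e).fst = h (root (own e))

attribute [instance] Diag.fintypeA Diag.fintypeE

namespace Diag

variable {L d : ℕ} {ι : Type}

/-- The number of hidden weights in a diagram. -/
def numW (D : Diag L d ι) : ℕ := (Finset.univ.filter fun e => (D.lab e).isW = true).card

/-- The parameters attached to the factors by an assignment of the width indices. -/
def par (D : Diag L d ι) {n : ℕ} (a : D.A → Fin n) (e : D.E) : Param L d n := (D.lab e).map a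

open Finset in
/-- Assignments of width indices that are compatible with a given Wick pairing. -/
theorem card_solutions_le [Fintype ι] (D : Diag L d ι) (P : Equiv.Perm D.E)
    (hP : ∀ e, P (P e) = e) (hne : ∀ e, P e ≠ e) {n : ℕ} (sol : Finset (D.A → Fin n))
    (hsol : ∀ a ∈ sol, ∀ e, D.par a (P e) = D.par a e) :
    sol = ∅ ∨ ∃ (r : ℕ) (R : Type) (_ : Fintype R) (_ : DecidableEq R) (ρ : ι → R),
      #sol ≤ n ^ r ∧ 2 * r ≤ D.numW + 2 * Fintype.card R ∧ Function.Surjective ρ ∧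
      (∀ e, ρ (D.own (P e)) = ρ (D.own e)) ∧ ∀ x, Even #{I | ρ I = x} := by
  classical
  rcases sol.eq_empty_or_nonempty with h0 | ⟨a₀, ha₀⟩
  · exact Or.inl h0
  right
  -- A single compatible assignment already shows that `P` preserves the kind of a factor, since
  -- relabelling does not change it.
  have hW : ∀ e, (D.lab (P e)).isW = (D.lab e).isW := fun e => by
    have := congrArg PIdx.isW (hsol a₀ ha₀ e)
    simpa [par] using this
  have hV : ∀ e, (D.lab (P e)).isV = (D.lab e).isV := fun e => by
    have := congrArg PIdx.isV (hsol a₀ ha₀ e)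
    simpa [par] using this
  let rel : D.A → D.A → Prop := fun u v => ∃ e,
    (u = (D.lab e).fst ∧ v = (D.lab (P e)).fst) ∨ (u = (D.lab e).snd ∧ v = (D.lab (P e)).snd)
  let q : D.A → Quot rel := Quot.mk rel
  have : Fintype (Quot rel) := Fintype.ofSurjective q Quot.mk_surjective
  have hq1 : ∀ e, q (D.lab (P e)).fst = q (D.lab e).fst := fun e =>
    (Quot.sound ⟨e, Or.inl ⟨rfl, rfl⟩⟩).symm
  have hq2 : ∀ e, q (D.lab (P e)).snd = q (D.lab e).snd := fun e =>
    (Quot.sound ⟨e, Or.inr ⟨rfl, rfl⟩⟩).symm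
  have hcard : #sol ≤ n ^ Fintype.card (Quot rel) := by
    have hresp : ∀ a ∈ sol, ∀ u v, rel u v → a u = a v := by
      rintro a ha u v ⟨e, ⟨rfl, rfl⟩ | ⟨rfl, rfl⟩⟩
      · have := congrArg PIdx.fst (hsol a ha e)
        simpa [par] using this.symm
      · have := congrArg PIdx.snd (hsol a ha e)
        simpa [par] using this.symm
    have hsub : sol ⊆ Finset.univ.image fun b : Quot rel → Fin n => b ∘ q := by
      intro a ha
      exact mem_image.2 ⟨Quot.lift a (hresp a ha), mem_univ _, rfl⟩
    refine (card_le_card hsub).trans (card_image_le.trans ?_)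
    simp
  -- The graph on the glued indices has the hidden weights as edges. Both `e` and `P e` give the
  -- same edge, so there are at most `numW / 2` edges; contracting them leaves a type `R` that plays
  -- the role of the set of components.
  let f : D.E → Quot rel × Quot rel := fun e => (q (D.lab e).fst, q (D.lab e).snd)
  let SW : Finset D.E := Finset.univ.filter fun e => (D.lab e).isW = true
  obtain ⟨R, _, π, hπ, hπS, hcardR⟩ := exists_merge (SW.image f)
  have hSW : 2 * #(SW.image f) ≤ D.numW := by
    refine mul_card_image_le_card SW 2 fun p hp => ?_
    obtain ⟨e, he, rfl⟩ := mem_image.1 hp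
    have heW : (D.lab e).isW = true := (mem_filter.1 he).2
    have hsub : ({e, P e} : Finset D.E) ⊆ {z ∈ SW | f z = f e} := by
      intro z hz
      rcases mem_insert.1 hz with rfl | hz
      · simp [he]
      · rw [mem_singleton] at hz
        subst hz
        simp [SW, f, hW, heW, hq1, hq2]
    calc 2 = #({e, P e} : Finset D.E) := (card_pair (hne e).symm).symm
      _ ≤ _ := card_le_card hsub
  have hh : ∀ e, (D.lab e).isW → (π ∘ q) (D.lab e).fst = (π ∘ q) (D.lab e).snd := by
    intro e he
    exact hπS (f e) (mem_image_of_mem f (by simp [SW, he]))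
  let ρ : ι → R := fun I => π (q (D.root I))
  have hρ : ∀ e, ρ (D.own (P e)) = ρ (D.own e) := by
    intro e
    have h1 := D.apply_fst_lab R (π ∘ q) hh e
    have h2 := D.apply_fst_lab R (π ∘ q) hh (P e)
    simp only [Function.comp_apply] at h1 h2
    rw [hq1, h1] at h2
    exact h2.symm
  refine ⟨Fintype.card (Quot rel), R, inferInstance, inferInstance, ρ, hcard, by omega, ?_, hρ, ?_⟩
  · intro r
    obtain ⟨x, rfl⟩ := hπ r
    obtain ⟨u, rfl⟩ := Quot.mk_surjective x
    obtain ⟨I, hI⟩ := D.exists_root R (π ∘ q) hh u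
    exact ⟨I, hI.symm⟩
  -- `P` permutes the output weights, one per diagram, and so induces a fixed-point-free involution
  -- of the diagrams that preserves components.
  · have hPv : ∀ I, P (D.vfac I) = D.vfac (D.own (P (D.vfac I))) := by
      intro I
      refine D.eq_vfac _ ?_
      rw [hV, D.lab_vfac]
      rfl
    refine even_card_filter_of_involution (fun I => D.own (P (D.vfac I))) ?_ ?_ ρ ?_
    · intro I
      simp only
      rw [← hPv, hP, D.own_vfac]
    · intro I hI
      have := hPv I
      rw [hI] at this
      exact hne _ this
    · intro I
      rw [hρ, D.own_vfac]

/-- Two independent copies of a diagram. -/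
def double (D : Diag L d ι) : Diag L d (ι ⊕ ι) where
  A := D.A ⊕ D.A
  E := D.E ⊕ D.E
  lab := Sum.elim (fun e => (D.lab e).map Sum.inl) (fun e => (D.lab e).map Sum.inr)
  own := Sum.map D.own D.own
  root := Sum.map D.root D.root
  vfac := Sum.map D.vfac D.vfac
  lab_vfac := by
    rintro (I | I) <;> simp only [Sum.map_inl, Sum.map_inr, Sum.elim_inl, Sum.elim_inr, lab_vfac] <;>
      rfl
  own_vfac := by rintro (I | I) <;> simp [own_vfac]
  eq_vfac := by
    rintro (e | e) h <;> simp only [Sum.elim_inl, Sum.elim_inr, PIdx.isV_map] at h <;>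
      simp [← D.eq_vfac e h]
  exists_root := by
    rintro Z h hh (u | u)
    · obtain ⟨I, hI⟩ := D.exists_root Z (h ∘ Sum.inl)
        (fun e he => by simpa using hh (Sum.inl e) (by simpa using he)) u
      exact ⟨Sum.inl I, hI⟩
    · obtain ⟨I, hI⟩ := D.exists_root Z (h ∘ Sum.inr)
        (fun e he => by simpa using hh (Sum.inr e) (by simpa using he)) u
      exact ⟨Sum.inr I, hI⟩
  apply_fst_lab := by
    rintro Z h hh (e | e)
    · simpa using D.apply_fst_lab Z (h ∘ Sum.inl)
        (fun e he => by simpa using hh (Sum.inl e) (by simpa using he)) e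
    · simpa using D.apply_fst_lab Z (h ∘ Sum.inr)
        (fun e he => by simpa using hh (Sum.inr e) (by simpa using he)) e

theorem numW_double (D : Diag L d ι) : D.double.numW = 2 * D.numW := by
  have h' : D.double.numW = ∑ e : D.E ⊕ D.E, if (D.double.lab e).isW = true then 1 else 0 := by
    rw [← Finset.card_filter]; rfl
  have h'' : D.numW = ∑ e : D.E, if (D.lab e).isW = true then 1 else 0 := by
    rw [← Finset.card_filter]; rfl
  rw [h', h'', Fintype.sum_sum_type, two_mul]
  simp [double]

end Diag

/-! ### Gaussian moments and covariances of monomials. -/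

section Moments

open Finset

/-- The moments of the standard Gaussian. -/
noncomputable def gaussMoment (k : ℕ) : ℝ := ∫ x, x ^ k ∂(gaussianReal 0 1)

theorem gaussMoment_zero : gaussMoment 0 = 1 := by simp [gaussMoment]

/-- The standard Gaussian is invariant under `x ↦ -x`. -/
theorem gaussMoment_of_odd {k : ℕ} (hk : Odd k) : gaussMoment k = 0 := by
  have h : gaussMoment k = ∫ x, x ^ k ∂((gaussianReal 0 1).map fun x => -x) := by
    rw [gaussianReal_map_neg, neg_zero, gaussMoment]
  rw [integral_map (by fun_prop) (by fun_prop)] at h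
  simp only [hk.neg_pow, integral_neg] at h
  rw [← gaussMoment] at h
  linarith

theorem integrable_pow_gaussianReal (k : ℕ) :
    Integrable (fun x : ℝ => x ^ k) (gaussianReal 0 1) := by
  refine (memLp_one_iff_integrable.1 ?_)
  by_cases hk : k = 0
  · subst hk; simpa using memLp_const (1 : ℝ)
  have := (memLp_id_gaussianReal' (μ := 0) (v := 1) k (by simp)).integrable_norm_pow hk
  refine memLp_one_iff_integrable.2 (this.mono (by fun_prop) (ae_of_all _ fun x => ?_))
  simp

theorem card_filter_disjSum {V E E' : Type} [DecidableEq V] (S : Finset E) (S' : Finset E') (p : E → V) (p' : E' → V) (ν : V) :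
    #{e ∈ S.disjSum S' | Sum.elim p p' e = ν} = #{e ∈ S | p e = ν} + #{e ∈ S' | p' e = ν} := by
  rw [card_filter, sum_disjSum, card_filter, card_filter]
  rfl

variable {V : Type} [Fintype V]

theorem integrable_monomial (k : V → ℕ) :
    Integrable (fun θ : V → ℝ => ∏ ν, θ ν ^ k ν) (Measure.pi fun _ => gaussianReal 0 1) :=
  Integrable.fintype_prod (f := fun ν (x : ℝ) => x ^ k ν)
    fun ν => integrable_pow_gaussianReal (k ν)

theorem integral_monomial (k : V → ℕ) :
    ∫ θ : V → ℝ, ∏ ν, θ ν ^ k ν ∂(Measure.pi fun _ => gaussianReal 0 1) =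
      ∏ ν, gaussMoment (k ν) :=
  integral_fintype_prod_eq_prod (f := fun ν (x : ℝ) => x ^ k ν)

/-- A bound for moments of monomials of degree `N`. -/
noncomputable def momentBound (N : ℕ) : ℝ := (1 + ∑ j ∈ range (N + 1), |gaussMoment j|) ^ N

theorem momentBound_nonneg (N : ℕ) : 0 ≤ momentBound N := by
  unfold momentBound; positivity

/-- A variable of exponent zero contributes 1; any other moment is at most the base of
`momentBound`, which is at least 1 and hence at most its own `k ν`-th power. The bound depends only
on the degree, not on the number of variables, and so is uniform in the width. -/
theorem abs_prod_gaussMoment_le (k : V → ℕ) :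
    |∏ ν, gaussMoment (k ν)| ≤ momentBound (∑ ν, k ν) := by
  rw [abs_prod, momentBound, ← prod_pow_eq_pow_sum]
  refine prod_le_prod (fun _ _ => abs_nonneg _) fun ν _ => ?_
  have h0 : 0 ≤ ∑ j ∈ range (∑ ν, k ν + 1), |gaussMoment j| := by positivity
  rcases Nat.eq_zero_or_pos (k ν) with h | h
  · simp [h, gaussMoment_zero]
  · refine le_trans ?_ (le_self_pow₀ (by linarith) h.ne')
    have hle : k ν ≤ ∑ ν, k ν := single_le_sum (fun _ _ => Nat.zero_le _) (mem_univ ν)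
    have := single_le_sum (f := fun j => |gaussMoment j|) (fun _ _ => abs_nonneg _)
      (mem_range.2 (Nat.lt_succ_of_le hle))
    linarith

variable {E E' : Type} [DecidableEq V]

theorem prod_eq_monomial (S : Finset E) (p : E → V) (θ : V → ℝ) :
    ∏ e ∈ S, θ (p e) = ∏ ν, θ ν ^ #{e ∈ S | p e = ν} := by
  rw [← prod_fiberwise (s := S) (g := p)]
  refine prod_congr rfl fun ν _ => ?_
  rw [prod_congr rfl fun e he => by rw [(mem_filter.1 he).2], prod_const]

theorem integrable_prod_coord (S : Finset E) (p : E → V) :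
    Integrable (fun θ : V → ℝ => ∏ e ∈ S, θ (p e)) (Measure.pi fun _ => gaussianReal 0 1) := by
  simp only [prod_eq_monomial]
  exact integrable_monomial _

theorem integral_prod_coord (S : Finset E) (p : E → V) :
    ∫ θ : V → ℝ, ∏ e ∈ S, θ (p e) ∂(Measure.pi fun _ => gaussianReal 0 1) =
      ∏ ν, gaussMoment #{e ∈ S | p e = ν} := by
  simp only [prod_eq_monomial]
  exact integral_monomial _

theorem abs_integral_prod_coord_le (S : Finset E) (p : E → V) :
    |∫ θ : V → ℝ, ∏ e ∈ S, θ (p e) ∂(Measure.pi fun _ => gaussianReal 0 1)| ≤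
      momentBound #S := by
  rw [integral_prod_coord, card_eq_sum_card_fiberwise (f := p) (t := univ) (by simp)]
  exact abs_prod_gaussMoment_le _

theorem even_of_integral_prod_coord_ne_zero {S : Finset E} {p : E → V}
    (h : ∫ θ : V → ℝ, ∏ e ∈ S, θ (p e) ∂(Measure.pi fun _ => gaussianReal 0 1) ≠ 0) (ν : V) :
    Even #{e ∈ S | p e = ν} := by
  rw [integral_prod_coord, prod_ne_zero_iff] at h
  by_contra hν
  exact h ν (mem_univ _) (gaussMoment_of_odd (Nat.not_even_iff_odd.1 hν))

/-- A nonzero covariance of two monomials forces even multiplicities and a common variable. -/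
theorem even_of_covariance_ne_zero {S : Finset E} {S' : Finset E'} {p : E → V} {p' : E' → V}
    (h : ∫ θ : V → ℝ, ∏ e ∈ S.disjSum S', θ (Sum.elim p p' e)
        ∂(Measure.pi fun _ => gaussianReal 0 1) -
      (∫ θ : V → ℝ, ∏ e ∈ S, θ (p e) ∂(Measure.pi fun _ => gaussianReal 0 1)) *
        ∫ θ : V → ℝ, ∏ e ∈ S', θ (p' e) ∂(Measure.pi fun _ => gaussianReal 0 1) ≠ 0) :
    (∀ ν, Even #{e ∈ S.disjSum S' | Sum.elim p p' e = ν}) ∧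
      ∃ e ∈ S, ∃ e' ∈ S', p e = p' e' := by
  constructor
  -- Either the joint moment or the product of the separate moments is nonzero; both give even total
  -- multiplicities.
  · by_cases h1 : ∫ θ : V → ℝ, ∏ e ∈ S.disjSum S', θ (Sum.elim p p' e)
        ∂(Measure.pi fun _ => gaussianReal 0 1) = 0
    · rw [h1, zero_sub, neg_ne_zero, mul_ne_zero_iff] at h
      intro ν
      rw [card_filter_disjSum]
      exact (even_of_integral_prod_coord_ne_zero h.1 ν).add
        (even_of_integral_prod_coord_ne_zero h.2 ν)
    · exact even_of_integral_prod_coord_ne_zero h1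
  · by_contra! hdis
    refine h ?_
    rw [sub_eq_zero]
    simp only [integral_prod_coord, card_filter_disjSum]
    -- Without a common variable, each variable has exponent zero in one of the monomials, so the
    -- joint moment factorizes.
    rw [← prod_mul_distrib]
    refine prod_congr rfl fun ν _ => ?_
    by_cases hν : ∃ e ∈ S, p e = ν
    · obtain ⟨e, he, rfl⟩ := hν
      have : #{e' ∈ S' | p' e' = p e} = 0 := by
        rw [card_eq_zero, filter_eq_empty_iff]
        exact fun e' he' h => hdis e he e' he' h.symm
      rw [this, add_zero, gaussMoment_zero, mul_one]
    · push Not at hν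
      have : #{e ∈ S | p e = ν} = 0 := by
        rw [card_eq_zero, filter_eq_empty_iff]
        exact fun e he h => hν e he h
      rw [this, zero_add, gaussMoment_zero, one_mul]

end Moments

/-! ### Wick pairings that extend the prescribed contractions. -/

section Pairings

open Finset

variable {E X K : Type*} [Fintype E] [Fintype K]

open Classical in
/-- The factors that are not consumed by derivatives. -/
noncomputable def rest (δ : K × Fin 2 ↪ E) : Finset E := (univ.map δ)ᶜ

theorem mem_rest {δ : K × Fin 2 ↪ E} {e : E} : e ∈ rest δ ↔ ∀ x, δ x ≠ e := by
  simp [rest]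

variable [DecidableEq E] [DecidableEq X]

/-- Fixed-point-free involutions extending a partial pairing. -/
def IsPairing (δ : K × Fin 2 ↪ E) (P : Equiv.Perm E) : Prop :=
  (∀ e, P (P e) = e) ∧ (∀ e, P e ≠ e) ∧ ∀ p, P (δ (p, 0)) = δ (p, 1)

/-- Swap the two members of each contracted pair, and pair the remaining factors within the fibres
of `g`. -/
theorem exists_isPairing (δ : K × Fin 2 ↪ E) (g : E → X)
    (hδ : ∀ p, g (δ (p, 0)) = g (δ (p, 1))) (h : ∀ x, Even #{e ∈ rest δ | g e = x}) :
    ∃ P, IsPairing δ P ∧ ∀ e, g (P e) = g e := by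
  obtain ⟨P, hP2, hPg, hPS, hPo⟩ := exists_perm_of_even_fibers g (rest δ) h
  let fl : K × Fin 2 → K × Fin 2 := fun x => (x.1, Equiv.swap 0 1 x.2)
  have hfl : Function.Involutive fl := fun x => by simp [fl]
  let F : Equiv.Perm E := (hfl.toPerm fl).viaFintypeEmbedding δ
  have hF : ∀ x, F (δ x) = δ (fl x) := fun x => Equiv.Perm.viaFintypeEmbedding_apply_image _ _ _
  have hF' : ∀ e ∈ rest δ, F e = e := fun e he =>
    Equiv.Perm.viaFintypeEmbedding_apply_notMem_range _ _ (by
      rintro ⟨x, hx⟩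
      exact mem_rest.1 he x hx)
  have hδr : ∀ x, δ x ∉ rest δ := fun x hx => mem_rest.1 hx x rfl
  have k1 : ∀ x, (P * F) (δ x) = δ (fl x) := fun x => by
    rw [Equiv.Perm.mul_apply, hF, hPo _ (hδr _)]
  have k2 : ∀ e ∈ rest δ, (P * F) e = P e := fun e he => by
    rw [Equiv.Perm.mul_apply, hF' e he]
  have k3 : ∀ e ∈ rest δ, P e ∈ rest δ := fun e he => by
    by_contra hcon
    have := hPo _ hcon
    rw [hP2] at this
    exact hPS e he this.symm
  have cases : ∀ e, e ∈ rest δ ∨ ∃ x, δ x = e := fun e => by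
    by_cases he : e ∈ rest δ
    · exact Or.inl he
    · right
      by_contra! hcon
      exact he (mem_rest.2 hcon)
  refine ⟨P * F, ⟨fun e => ?_, fun e => ?_, fun p => ?_⟩, fun e => ?_⟩
  · rcases cases e with he | ⟨x, rfl⟩
    · rw [k2 e he, k2 _ (k3 e he), hP2]
    · rw [k1, k1, hfl]
  · rcases cases e with he | ⟨x, rfl⟩
    · rw [k2 e he]; exact hPS e he
    · rw [k1]
      intro hcon
      have := congrArg Prod.snd (δ.injective hcon)
      obtain ⟨p, b⟩ := x
      fin_cases b <;> simp [fl] at this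
  · rw [k1]; simp [fl]
  · rcases cases e with he | ⟨x, rfl⟩
    · rw [k2 e he, hPg]
    · rw [k1]
      obtain ⟨p, b⟩ := x
      fin_cases b <;> simp [fl, hδ]

/-- Two unconsumed factors with the same image can be prescribed to be a pair. -/
theorem exists_isPairing_of_eq (δ : K × Fin 2 ↪ E) (g : E → X)
    (hδ : ∀ p, g (δ (p, 0)) = g (δ (p, 1))) (h : ∀ x, Even #{e ∈ rest δ | g e = x}) {e e' : E}
    (he : e ∈ rest δ) (he' : e' ∈ rest δ) (hne : e' ≠ e) (hg : g e = g e') :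
    ∃ P, IsPairing δ P ∧ (∀ e, g (P e) = g e) ∧ P e = e' := by
  -- The prescribed pair is added as one more contraction, indexed by `none`.
  let f : Option K × Fin 2 → E := fun x =>
    match x.1 with
    | some p => δ (p, x.2)
    | none => if x.2 = 0 then e else e'
  have hf : Function.Injective f := by
    rintro ⟨_ | p, b⟩ ⟨_ | p', b'⟩ hx
    · fin_cases b <;> fin_cases b' <;> simp_all [f]
    · exfalso
      fin_cases b
      · exact mem_rest.1 he _ (by simpa [f] using hx.symm)
      · exact mem_rest.1 he' _ (by simpa [f] using hx.symm)
    · exfalso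
      fin_cases b'
      · exact mem_rest.1 he _ (by simpa [f] using hx)
      · exact mem_rest.1 he' _ (by simpa [f] using hx)
    · have := δ.injective hx
      simp_all
  let δ' : Option K × Fin 2 ↪ E := ⟨f, hf⟩
  have hrest : rest δ' = ((rest δ).erase e).erase e' := by
    ext z
    simp only [mem_erase, mem_rest]
    constructor
    · intro hz
      refine ⟨fun h => hz (none, 1) ?_, fun h => hz (none, 0) ?_, fun x => hz (some x.1, x.2)⟩
      · simp [δ', f, h]
      · simp [δ', f, h]
    · rintro ⟨h1, h2, h3⟩ ⟨_ | p, b⟩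
      · fin_cases b
        · simpa [δ', f] using Ne.symm h2
        · simpa [δ', f] using Ne.symm h1
      · exact h3 (p, b)
  obtain ⟨P, ⟨hP1, hP2, hP3⟩, hPg⟩ := exists_isPairing δ' g
    (by
      rintro (_ | p)
      · simpa [δ', f] using hg
      · exact hδ p)
    (by
      intro x
      rw [hrest, filter_erase, filter_erase]
      by_cases hx : g e = x
      · have h2 : e ∈ {z ∈ rest δ | g z = x} := by simp [he, hx]
        have h3 : e' ∈ ({z ∈ rest δ | g z = x}).erase e := by simp [he', hne, ← hg, hx]
        rw [card_erase_of_mem h3, card_erase_of_mem h2]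
        obtain ⟨k, hk⟩ := h x
        exact ⟨k - 1, by omega⟩
      · have h2 : e ∉ {z ∈ rest δ | g z = x} := by simp [hx]
        have h3 : e' ∉ {z ∈ rest δ | g z = x} := by simp [← hg, hx]
        rw [erase_eq_of_notMem h2, erase_eq_of_notMem h3]
        exact h x)
  exact ⟨P, ⟨hP1, hP2, fun p => hP3 (some p)⟩, hPg, by simpa [δ', f] using hP3 none⟩

end Pairings

/-! ### Amplitudes: bounds on mean and variance. -/

namespace Diag

open Finset Classical

variable {L d : ℕ} {ι K : Type} [Fintype K]

/-- The pairing `P` admits at most `b / 2` connected components. -/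
def ComponentBound [Fintype ι] (D : Diag L d ι) (P : Equiv.Perm D.E) (b : ℕ) : Prop :=
  ∀ (R : Type) [Fintype R] (ρ : ι → R), Function.Surjective ρ →
    (∀ e, ρ (D.own (P e)) = ρ (D.own e)) → (∀ x, Even #{I | ρ I = x}) → 2 * Fintype.card R ≤ b

/-- A union bound over the pairings, whose number does not depend on `n`. For each, the exponent of
`√n` is `2 r ≤ numW + 2 #R ≤ numW + b`. -/
theorem card_good_le [Fintype ι] (D : Diag L d ι) (Ps : Set (Equiv.Perm D.E))
    (hPs : ∀ P ∈ Ps, (∀ e, P (P e) = e) ∧ ∀ e, P e ≠ e) (b : ℕ)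
    (hb : ∀ P ∈ Ps, D.ComponentBound P b) {n : ℕ} (hn : 1 ≤ n) :
    (#{a : D.A → Fin n | ∃ P ∈ Ps, ∀ e, D.par a (P e) = D.par a e} : ℝ) ≤
      Fintype.card (Equiv.Perm D.E) * √(n : ℝ) ^ (D.numW + b) := by
  have hs : 1 ≤ √(n : ℝ) := by
    rw [Real.one_le_sqrt]; exact_mod_cast hn
  let sol : Equiv.Perm D.E → Finset (D.A → Fin n) := fun P =>
    {a | P ∈ Ps ∧ ∀ e, D.par a (P e) = D.par a e}
  have hsub : ({a : D.A → Fin n | ∃ P ∈ Ps, ∀ e, D.par a (P e) = D.par a e} : Finset _) ⊆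
      univ.biUnion sol := by
    intro a ha
    obtain ⟨P, hP⟩ := (mem_filter.1 ha).2
    exact mem_biUnion.2 ⟨P, mem_univ _, by simpa [sol] using hP⟩
  have hsol : ∀ P, (#(sol P) : ℝ) ≤ √(n : ℝ) ^ (D.numW + b) := by
    intro P
    by_cases hP : P ∈ Ps
    · rcases D.card_solutions_le P (hPs P hP).1 (hPs P hP).2 (sol P)
        (fun a ha => (mem_filter.1 ha).2.2) with h | ⟨r, R, _, _, ρ, hr, hr2, h1, h2, h3⟩
      · rw [h]; simp only [card_empty, Nat.cast_zero]; positivity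
      · have hR := hb P hP R ρ h1 h2 (fun x => by convert h3 x)
        calc (#(sol P) : ℝ) ≤ (n : ℝ) ^ r := by exact_mod_cast hr
          _ = √(n : ℝ) ^ (2 * r) := by rw [pow_mul, Real.sq_sqrt (Nat.cast_nonneg n)]
          _ ≤ _ := pow_le_pow_right₀ hs (by omega)
    · have : sol P = ∅ := by simp [sol, hP]
      rw [this]; simp only [card_empty, Nat.cast_zero]; positivity
  calc (#{a : D.A → Fin n | ∃ P ∈ Ps, ∀ e, D.par a (P e) = D.par a e} : ℝ)
      ≤ ∑ P, (#(sol P) : ℝ) := by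
        exact_mod_cast (card_le_card hsub).trans card_biUnion_le
    _ ≤ ∑ _P : Equiv.Perm D.E, √(n : ℝ) ^ (D.numW + b) := sum_le_sum fun P _ => hsol P
    _ = _ := by simp

/-- Whether an assignment of width indices is compatible with the contractions `δ`. -/
def Contracts (D : Diag L d ι) (δ : K × Fin 2 ↪ D.E) {n : ℕ} (a : D.A → Fin n) : Prop :=
  ∀ p, D.par a (δ (p, 0)) = D.par a (δ (p, 1))

/-- One summand of the amplitude. -/
noncomputable def ampTerm (D : Diag L d ι) (δ : K × Fin 2 ↪ D.E) {n : ℕ} (a : D.A → Fin n)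
    (θ : Param L d n → ℝ) : ℝ :=
  if D.Contracts δ a then ∏ e ∈ rest δ, θ (D.par a e) else 0

/-- The amplitude of a diagram some of whose factors are contracted in pairs. -/
noncomputable def amp (D : Diag L d ι) (δ : K × Fin 2 ↪ D.E) (n : ℕ)
    (θ : Param L d n → ℝ) : ℝ :=
  ∑ a : D.A → Fin n, D.ampTerm δ a θ

theorem integrable_ampTerm (D : Diag L d ι) (δ : K × Fin 2 ↪ D.E) {n : ℕ} (a : D.A → Fin n) :
    Integrable (D.ampTerm δ a) (initLaw L d n) := by
  unfold ampTerm
  by_cases h : D.Contracts δ a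
  · simp only [h, if_true]
    exact integrable_prod_coord (rest δ) (D.par a)
  · simp [h]

/-- Only assignments compatible with some pairing have nonzero expectation; each contributes at most
a constant, and `card_good_le` counts them. -/
theorem abs_integral_amp_le [Fintype ι] (D : Diag L d ι) (δ : K × Fin 2 ↪ D.E) (b : ℕ)
    (hb : ∀ P, IsPairing δ P → D.ComponentBound P b) :
    ∃ C : ℝ, ∀ n : ℕ, 1 ≤ n →
      |∫ θ, D.amp δ n θ ∂(initLaw L d n)| ≤ C * √(n : ℝ) ^ (D.numW + b) := by
  refine ⟨momentBound #(rest δ) * Fintype.card (Equiv.Perm D.E), fun n hn => ?_⟩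
  have hterm : ∀ a : D.A → Fin n, |∫ θ, D.ampTerm δ a θ ∂(initLaw L d n)| ≤
      if ∃ P ∈ {P | IsPairing δ P}, ∀ e, D.par a (P e) = D.par a e
        then momentBound #(rest δ) else 0 := by
    intro a
    by_cases hc : D.Contracts δ a
    · have heq : ∫ θ, D.ampTerm δ a θ ∂(initLaw L d n) =
          ∫ θ, ∏ e ∈ rest δ, θ (D.par a e) ∂(initLaw L d n) := by simp [ampTerm, hc]
      rw [heq]
      by_cases h0 : ∫ θ, ∏ e ∈ rest δ, θ (D.par a e) ∂(initLaw L d n) = 0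
      · rw [h0, abs_zero]
        split_ifs
        exacts [momentBound_nonneg _, le_rfl]
      · obtain ⟨P, hP, hP'⟩ := exists_isPairing δ (D.par a) hc
          (even_of_integral_prod_coord_ne_zero h0)
        rw [if_pos ⟨P, hP, hP'⟩]
        exact abs_integral_prod_coord_le _ _
    · have : ∀ θ, D.ampTerm δ a θ = 0 := fun θ => by simp [ampTerm, hc]
      simp only [this, integral_zero, abs_zero]
      split_ifs
      exacts [momentBound_nonneg _, le_rfl]
  have hg := D.card_good_le {P | IsPairing δ P} (fun P hP => ⟨hP.1, hP.2.1⟩) b hb hn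
  unfold amp
  rw [integral_finsetSum _ fun a _ => D.integrable_ampTerm δ a]
  refine (abs_sum_le_sum_abs _ _).trans ((sum_le_sum fun a _ => hterm a).trans ?_)
  rw [← sum_filter, sum_const, nsmul_eq_mul, mul_comm, mul_assoc]
  exact mul_le_mul_of_nonneg_left hg (momentBound_nonneg _)

/-- The contractions of two copies of a diagram. -/
def doubleEmb {E : Type} (δ : K × Fin 2 ↪ E) : (K ⊕ K) × Fin 2 ↪ E ⊕ E :=
  (Equiv.sumProdDistrib K K (Fin 2)).toEmbedding.trans (δ.sumMap δ)

theorem rest_doubleEmb {E : Type} [Fintype E] (δ : K × Fin 2 ↪ E) :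
    rest (doubleEmb δ) = (rest δ).disjSum (rest δ) := by
  ext (e | e)
  · simp only [mem_rest, inl_mem_disjSum]
    constructor
    · exact fun h x hx => h (Sum.inl x.1, x.2) (by simp [doubleEmb, hx])
    · rintro h ⟨p | p, i⟩
      · simpa [doubleEmb] using h (p, i)
      · simp [doubleEmb]
  · simp only [mem_rest, inr_mem_disjSum]
    constructor
    · exact fun h x hx => h (Sum.inr x.1, x.2) (by simp [doubleEmb, hx])
    · rintro h ⟨p | p, i⟩
      · simp [doubleEmb]
      · simpa [doubleEmb] using h (p, i)

theorem par_double (D : Diag L d ι) {n : ℕ} (a a' : D.A → Fin n) :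
    D.double.par (Sum.elim a a') = Sum.elim (D.par a) (D.par a') := by
  funext e
  rcases e with e | e <;> simp [double, par, PIdx.map_map]

theorem ampTerm_mul (D : Diag L d ι) (δ : K × Fin 2 ↪ D.E) {n : ℕ} (a a' : D.A → Fin n)
    (hc : D.Contracts δ a) (hc' : D.Contracts δ a') (θ : Param L d n → ℝ) :
    D.ampTerm δ a θ * D.ampTerm δ a' θ =
      ∏ e ∈ (rest δ).disjSum (rest δ), θ (Sum.elim (D.par a) (D.par a') e) := by
  rw [prod_disjSum]
  simp [ampTerm, hc, hc']

theorem integrable_ampTerm_mul (D : Diag L d ι) (δ : K × Fin 2 ↪ D.E) {n : ℕ}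
    (a a' : D.A → Fin n) :
    Integrable (fun θ => D.ampTerm δ a θ * D.ampTerm δ a' θ) (initLaw L d n) := by
  by_cases hc : D.Contracts δ a
  · by_cases hc' : D.Contracts δ a'
    · simp only [D.ampTerm_mul δ a a' hc hc']
      exact integrable_prod_coord _ _
    · simp [ampTerm, hc']
  · simp [ampTerm, hc]

theorem memLp_amp (D : Diag L d ι) (δ : K × Fin 2 ↪ D.E) (n : ℕ) :
    MemLp (D.amp δ n) 2 (initLaw L d n) := by
  have : D.amp δ n = fun θ => ∑ a : D.A → Fin n, D.ampTerm δ a θ := rfl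
  rw [this]
  refine memLp_finsetSum _ fun a _ => ?_
  refine (memLp_two_iff_integrable_sq (D.integrable_ampTerm δ a).aestronglyMeasurable).2 ?_
  simpa only [sq] using D.integrable_ampTerm_mul δ a a

/-- The variance is a double sum of covariances, that is, a sum over assignments of the doubled
diagram. A nonzero covariance supplies a factor common to both copies, so only pairings that cross
between the copies have to be counted. -/
theorem abs_variance_amp_le [Fintype ι] (D : Diag L d ι) (δ : K × Fin 2 ↪ D.E) (b : ℕ)
    (hb : ∀ P : Equiv.Perm (D.E ⊕ D.E), IsPairing (doubleEmb δ) P →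
      (∃ e e', P (Sum.inl e) = Sum.inr e') → D.double.ComponentBound P b) :
    ∃ C : ℝ, ∀ n : ℕ, 1 ≤ n →
      variance (D.amp δ n) (initLaw L d n) ≤ C * √(n : ℝ) ^ (2 * D.numW + b) := by
  set N := #((rest δ).disjSum (rest δ)) with hN
  -- The two summands bound the joint moment and the product of the separate moments.
  set B : ℝ := momentBound N + momentBound #(rest δ) * momentBound #(rest δ) with hB
  have hB0 : 0 ≤ B := add_nonneg (momentBound_nonneg _)
    (mul_nonneg (momentBound_nonneg _) (momentBound_nonneg _))
  refine ⟨B * Fintype.card (Equiv.Perm D.double.E), fun n hn => ?_⟩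
  let Ps : Set (Equiv.Perm D.double.E) :=
    {P | IsPairing (doubleEmb δ) P ∧ ∃ e e', P (Sum.inl e) = Sum.inr e'}
  let μ := initLaw L d n
  have : IsProbabilityMeasure μ := by
    change IsProbabilityMeasure (Measure.pi _); infer_instance
  have hterm : ∀ a a' : D.A → Fin n,
      (∫ θ, D.ampTerm δ a θ * D.ampTerm δ a' θ ∂μ) -
        (∫ θ, D.ampTerm δ a θ ∂μ) * ∫ θ, D.ampTerm δ a' θ ∂μ ≤
      if ∃ P ∈ Ps, ∀ e, D.double.par (Sum.elim a a') (P e) = D.double.par (Sum.elim a a') e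
        then B else 0 := by
    intro a a'
    have hnn : 0 ≤ if ∃ P ∈ Ps, ∀ e, D.double.par (Sum.elim a a') (P e) =
        D.double.par (Sum.elim a a') e then B else 0 := by
      split_ifs
      exacts [hB0, le_rfl]
    by_cases hc : D.Contracts δ a
    swap
    · simpa [ampTerm, hc] using hnn
    by_cases hc' : D.Contracts δ a'
    swap
    · simpa [ampTerm, hc'] using hnn
    simp only [D.ampTerm_mul δ a a' hc hc']
    have h1 : ∀ θ, D.ampTerm δ a θ = ∏ e ∈ rest δ, θ (D.par a e) := fun θ => by
      simp [ampTerm, hc]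
    have h2 : ∀ θ, D.ampTerm δ a' θ = ∏ e ∈ rest δ, θ (D.par a' e) := fun θ => by
      simp [ampTerm, hc']
    simp only [h1, h2]
    by_cases h0 : (∫ θ, ∏ e ∈ (rest δ).disjSum (rest δ), θ (Sum.elim (D.par a) (D.par a') e) ∂μ) -
        (∫ θ, ∏ e ∈ rest δ, θ (D.par a e) ∂μ) * ∫ θ, ∏ e ∈ rest δ, θ (D.par a' e) ∂μ = 0
    · rw [h0]; exact hnn
    · obtain ⟨heven, e, he, e', he', hee⟩ := even_of_covariance_ne_zero h0
      obtain ⟨P, hP, hP', hPe⟩ := exists_isPairing_of_eq (doubleEmb δ)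
        (Sum.elim (D.par a) (D.par a'))
        (by
          rintro (p | p)
          · simpa [doubleEmb] using hc p
          · simpa [doubleEmb] using hc' p)
        (by rw [rest_doubleEmb]; exact heven) (e := Sum.inl e) (e' := Sum.inr e')
        (by rw [rest_doubleEmb]; simpa using he) (by rw [rest_doubleEmb]; simpa using he')
        (by simp) (by simpa using hee)
      rw [if_pos ⟨P, ⟨hP, e, e', hPe⟩, by rw [par_double]; exact hP'⟩]
      refine (le_abs_self _).trans ((abs_sub _ _).trans ?_)
      rw [abs_mul]
      exact add_le_add (abs_integral_prod_coord_le _ _)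
        (mul_le_mul (abs_integral_prod_coord_le _ _) (abs_integral_prod_coord_le _ _)
          (abs_nonneg _) (momentBound_nonneg _))
  have hg := D.double.card_good_le Ps (fun P hP => ⟨hP.1.1, hP.1.2.1⟩) b
    (fun P hP => hb P hP.1 hP.2) hn
  have hvar : variance (D.amp δ n) μ = ∑ a : D.A → Fin n, ∑ a' : D.A → Fin n,
      ((∫ θ, D.ampTerm δ a θ * D.ampTerm δ a' θ ∂μ) -
        (∫ θ, D.ampTerm δ a θ ∂μ) * ∫ θ, D.ampTerm δ a' θ ∂μ) := by
    rw [variance_eq_sub (D.memLp_amp δ n)]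
    have h1 : (∫ θ, D.amp δ n θ ∂μ) = ∑ a : D.A → Fin n, ∫ θ, D.ampTerm δ a θ ∂μ :=
      integral_finsetSum _ fun a _ => D.integrable_ampTerm δ a
    have h2 : (∫ θ, (D.amp δ n ^ 2) θ ∂μ) = ∑ a : D.A → Fin n, ∑ a' : D.A → Fin n,
        ∫ θ, D.ampTerm δ a θ * D.ampTerm δ a' θ ∂μ := by
      have : ∀ θ, (D.amp δ n ^ 2) θ = ∑ a : D.A → Fin n, ∑ a' : D.A → Fin n,
          D.ampTerm δ a θ * D.ampTerm δ a' θ := fun θ => by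
        rw [Pi.pow_apply, sq, amp, sum_mul_sum]
      simp only [this]
      rw [integral_finsetSum _ fun a _ => integrable_finsetSum _ fun a' _ =>
        D.integrable_ampTerm_mul δ a a']
      exact sum_congr rfl fun a _ => integral_finsetSum _ fun a' _ =>
        D.integrable_ampTerm_mul δ a a'
    rw [h1, h2, sq, sum_mul_sum, ← sum_sub_distrib]
    simp only [sum_sub_distrib]
  rw [hvar]
  refine (sum_le_sum fun a _ => sum_le_sum fun a' _ => hterm a a').trans ?_
  rw [← Fintype.sum_prod_type', ← (Equiv.sumArrowEquivProdArrow D.A D.A (Fin n)).sum_comp]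
  have hel : ∀ c : D.A ⊕ D.A → Fin n, Sum.elim
      ((Equiv.sumArrowEquivProdArrow D.A D.A (Fin n)) c).1
      ((Equiv.sumArrowEquivProdArrow D.A D.A (Fin n)) c).2 = c := fun c => by
    funext x; rcases x with x | x <;> rfl
  simp only [hel]
  rw [← sum_filter, sum_const, nsmul_eq_mul, mul_comm, mul_assoc, ← numW_double]
  refine mul_le_mul_of_nonneg_left (le_trans (le_of_eq ?_) hg) hB0
  norm_cast
  exact Finset.card_bij (fun c _ => c)
    (fun c hc => mem_filter.2 ⟨mem_univ _, (mem_filter.1 hc).2⟩) (fun _ _ _ _ h => h)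
    (fun c hc => ⟨c, mem_filter.2 ⟨mem_univ _, (mem_filter.1 hc).2⟩, rfl⟩)

end Diag

/-! ### Rooted diagrams and the operations that build a network from them. -/

/-- A connected diagram with a distinguished root `none`, other width indices `N`, factors `EU`
that are input weights and factors `EW` that are hidden weights. -/
structure RDiag (L d : ℕ) where
  N : Type
  EU : Type
  EW : Type
  [fintypeN : Fintype N]
  [decidableEqN : DecidableEq N]
  [fintypeEU : Fintype EU]
  [fintypeEW : Fintype EW]
  labU : EU → Option N × Fin d
  labW : EW → Fin L × Option N × Option N
  conn : ∀ (Z : Type) (h : Option N → Z), (∀ e, h (labW e).2.1 = h (labW e).2.2) →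
    ∀ u, h u = h none

attribute [instance] RDiag.fintypeN RDiag.decidableEqN RDiag.fintypeEU RDiag.fintypeEW

namespace RDiag

variable {L d : ℕ}

/-- The product of the factors of a rooted diagram. -/
def weight (D : RDiag L d) {n : ℕ} (θ : Param L d n → ℝ) (a : Option D.N → Fin n) : ℝ :=
  (∏ e, θ (Param.U (a (D.labU e).1) (D.labU e).2)) *
    ∏ e, θ (Param.W (D.labW e).1 (a (D.labW e).2.1) (a (D.labW e).2.2))

/-- The normalized value of a rooted diagram whose root has index `i`. -/
noncomputable def val (D : RDiag L d) {n : ℕ} (θ : Param L d n → ℝ) (i : Fin n) : ℝ :=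
  (√(n : ℝ))⁻¹ ^ Fintype.card D.EW * ∑ a : D.N → Fin n, D.weight θ fun o => o.elim i a

/-- The diagram with no factors. -/
def one (L d : ℕ) : RDiag L d where
  N := Empty
  EU := Empty
  EW := Empty
  labU := Empty.elim
  labW := Empty.elim
  conn := by rintro Z h - (_ | ⟨⟨⟩⟩); rfl

theorem val_one {n : ℕ} (θ : Param L d n → ℝ) (i : Fin n) : (one L d).val θ i = 1 := by
  have : IsEmpty (one L d).N := inferInstanceAs (IsEmpty Empty)
  have : IsEmpty (one L d).EU := inferInstanceAs (IsEmpty Empty)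
  have : IsEmpty (one L d).EW := inferInstanceAs (IsEmpty Empty)
  simp [val, weight]

/-- The diagram with a single input weight. -/
def input (L : ℕ) {d : ℕ} (α : Fin d) : RDiag L d where
  N := Empty
  EU := Unit
  EW := Empty
  labU := fun _ => (none, α)
  labW := Empty.elim
  conn := by rintro Z h - (_ | ⟨⟨⟩⟩); rfl

theorem val_input {n : ℕ} (α : Fin d) (θ : Param L d n → ℝ) (i : Fin n) :
    (input L α).val θ i = θ (Param.U i α) := by
  have : IsEmpty (input L α).N := inferInstanceAs (IsEmpty Empty)
  let : Unique (input L α).EU := inferInstanceAs (Unique Unit)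
  have : IsEmpty (input L α).EW := inferInstanceAs (IsEmpty Empty)
  have h : (input L α).labU default = (none, α) := rfl
  simp [val, weight, h]

/-- Two diagrams glued at their roots. -/
def mul (D D' : RDiag L d) : RDiag L d where
  N := D.N ⊕ D'.N
  EU := D.EU ⊕ D'.EU
  EW := D.EW ⊕ D'.EW
  labU := Sum.elim (fun e => Prod.map (Option.map Sum.inl) id (D.labU e))
    (fun e => Prod.map (Option.map Sum.inr) id (D'.labU e))
  labW := Sum.elim
    (fun e => Prod.map id (Prod.map (Option.map Sum.inl) (Option.map Sum.inl)) (D.labW e))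
    (fun e => Prod.map id (Prod.map (Option.map Sum.inr) (Option.map Sum.inr)) (D'.labW e))
  conn := by
    rintro Z h hh (_ | (u | u))
    · rfl
    · simpa using D.conn Z (fun o => h (o.map Sum.inl)) (fun e => hh (Sum.inl e)) (some u)
    · simpa using D'.conn Z (fun o => h (o.map Sum.inr)) (fun e => hh (Sum.inr e)) (some u)

theorem weight_mul (D D' : RDiag L d) {n : ℕ} (θ : Param L d n → ℝ)
    (a : Option (D.N ⊕ D'.N) → Fin n) :
    (D.mul D').weight θ a = D.weight θ (fun o => a (o.map Sum.inl)) *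
      D'.weight θ (fun o => a (o.map Sum.inr)) := by
  unfold weight mul
  simp only [Fintype.prod_sum_type, Sum.elim_inl, Sum.elim_inr, Prod.map_fst, Prod.map_snd, id]
  ring

theorem val_mul (D D' : RDiag L d) {n : ℕ} (θ : Param L d n → ℝ) (i : Fin n) :
    (D.mul D').val θ i = D.val θ i * D'.val θ i := by
  have h1 : Fintype.card (D.mul D').EW = Fintype.card D.EW + Fintype.card D'.EW :=
    Fintype.card_sum
  have h2 : ∑ a : (D.mul D').N → Fin n, (D.mul D').weight θ (fun o => o.elim i a) =
      (∑ a : D.N → Fin n, D.weight θ fun o => o.elim i a) *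
        ∑ a : D'.N → Fin n, D'.weight θ fun o => o.elim i a := by
    rw [Finset.sum_mul_sum, ← Fintype.sum_prod_type',
      ← (Equiv.sumArrowEquivProdArrow D.N D'.N (Fin n)).sum_comp]
    refine Finset.sum_congr rfl fun a _ => ?_
    refine (weight_mul D D' θ _).trans ?_
    congr 2 <;> funext o <;> rcases o with _ | o <;> rfl
  rw [val, h1, h2, val, val, pow_add]
  ring

/-- The diagram with a hidden weight attached above the root. -/
def step (ℓ : Fin L) (D : RDiag L d) : RDiag L d where
  N := Option D.N
  EU := D.EU
  EW := Option D.EW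
  labU := fun e => Prod.map some id (D.labU e)
  labW := fun e => e.elim (ℓ, none, some none) fun e => Prod.map id (Prod.map some some) (D.labW e)
  conn := by
    intro Z h hh u
    have h0 : h none = h (some none) := hh none
    rcases u with _ | u
    · rfl
    · rw [h0]
      exact D.conn Z (fun o => h (some o)) (fun e => hh (some e)) u

theorem val_step (ℓ : Fin L) (D : RDiag L d) {n : ℕ} (θ : Param L d n → ℝ) (i : Fin n) :
    (D.step ℓ).val θ i = (√(n : ℝ))⁻¹ * ∑ j, θ (Param.W ℓ i j) * D.val θ j := by
  have h1 : Fintype.card (D.step ℓ).EW = Fintype.card D.EW + 1 := Fintype.card_option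
  have h2 : ∑ a : (D.step ℓ).N → Fin n, (D.step ℓ).weight θ (fun o => o.elim i a) =
      ∑ j, θ (Param.W ℓ i j) * ∑ a : D.N → Fin n, D.weight θ fun o => o.elim j a := by
    simp only [Finset.mul_sum]
    rw [← Fintype.sum_prod_type',
      ← (Equiv.piOptionEquivProd (β := fun _ : Option D.N => Fin n)).sum_comp]
    refine Finset.sum_congr rfl fun a _ => ?_
    unfold weight step
    simp only [Fintype.prod_option]
    have : (fun o : Option D.N => o.elim (a none) fun x => a (some x)) = a := by
      funext o; cases o <;> rfl
    simp only [Option.elim, Equiv.piOptionEquivProd, Equiv.coe_fn_mk, Prod.map_fst, Prod.map_snd, id]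
    rw [mul_left_comm]
    congr 2 <;> refine Finset.prod_congr rfl fun e _ => ?_
    · rcases (D.labU e).1 with _ | x <;> rfl
    · rcases (D.labW e).2.1 with _ | x <;> rcases (D.labW e).2.2 with _ | y <;> rfl
  rw [val, h1, h2, pow_succ]
  simp only [val, Finset.mul_sum]
  refine Finset.sum_congr rfl fun j _ => Finset.sum_congr rfl fun a _ => ?_
  ring

/-- The factors of a rooted diagram completed by an output weight at the root. -/
abbrev E (D : RDiag L d) : Type := D.EU ⊕ D.EW ⊕ Unit

/-- The labels of the factors of the completed diagram. -/
def lab (D : RDiag L d) : D.E → PIdx L d (Option D.N) :=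
  Sum.map D.labU (Sum.map D.labW fun _ => none)

theorem prod_lab (D : RDiag L d) {n : ℕ} (θ : Param L d n → ℝ) (a : Option D.N → Fin n) :
    ∏ e, θ ((D.lab e).map a) = θ (Param.V (a none)) * D.weight θ a := by
  rw [Fintype.prod_sum_type, Fintype.prod_sum_type, ← mul_assoc, mul_comm]
  rw [Fintype.prod_unique]
  rfl

/-- The family of completed diagrams. -/
def family {ι : Type} [Fintype ι] (D : ι → RDiag L d) : Diag L d ι where
  A := Σ I, Option (D I).N
  E := Σ I, (D I).E
  lab := fun e => ((D e.1).lab e.2).map (Sigma.mk e.1)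
  own := Sigma.fst
  root := fun I => ⟨I, none⟩
  vfac := fun I => ⟨I, Sum.inr (Sum.inr ())⟩
  lab_vfac := fun _ => rfl
  own_vfac := fun _ => rfl
  eq_vfac := by
    rintro ⟨I, e | e | ⟨⟩⟩ h
    · exact absurd h Bool.false_ne_true
    · exact absurd h Bool.false_ne_true
    · rfl
  exists_root := by
    rintro Z h hh ⟨I, u⟩
    exact ⟨I, (D I).conn Z (fun u => h ⟨I, u⟩)
      (fun e => hh ⟨I, Sum.inr (Sum.inl e)⟩ rfl) u⟩
  apply_fst_lab := by
    rintro Z h hh ⟨I, e⟩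
    rw [PIdx.fst_map]
    exact (D I).conn Z (fun u => h ⟨I, u⟩) (fun e => hh ⟨I, Sum.inr (Sum.inl e)⟩ rfl) _

theorem numW_family {ι : Type} [Fintype ι] (D : ι → RDiag L d) :
    (family D).numW = ∑ I, Fintype.card (D I).EW := by
  have h : (family D).numW =
      ∑ e : Σ I, (D I).E, if ((family D).lab e).isW = true then 1 else 0 := by
    rw [← Finset.card_filter]; rfl
  rw [h, Fintype.sum_sigma]
  refine Finset.sum_congr rfl fun I _ => ?_
  have h1 : ∀ e, ((family D).lab ⟨I, Sum.inl e⟩).isW = false := fun _ => rfl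
  have h2 : ∀ e, ((family D).lab ⟨I, Sum.inr (Sum.inl e)⟩).isW = true := fun _ => rfl
  have h3 : ∀ e, ((family D).lab ⟨I, Sum.inr (Sum.inr e)⟩).isW = false := fun _ => rfl
  rw [Fintype.sum_sum_type, Fintype.sum_sum_type]
  simp only [h1, h2, h3]
  simp

end RDiag

/-! ### Expansion of the network function in diagrams. -/

section Expansion

variable {L d : ℕ}

/-- Linear combinations of rooted diagrams with coefficients that do not depend on the width. -/
def IsDiagSum (g : ∀ n, (Param L d n → ℝ) → Fin n → ℝ) : Prop :=
  ∃ (T : Type) (_ : Fintype T) (c : T → ℝ) (D : T → RDiag L d),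
    ∀ n θ i, g n θ i = ∑ t, c t * (D t).val θ i

namespace IsDiagSum

variable {g g' : ∀ n, (Param L d n → ℝ) → Fin n → ℝ}

theorem add (h : IsDiagSum g) (h' : IsDiagSum g') :
    IsDiagSum fun n θ i => g n θ i + g' n θ i := by
  obtain ⟨T, _, c, D, hg⟩ := h
  obtain ⟨T', _, c', D', hg'⟩ := h'
  refine ⟨T ⊕ T', inferInstance, Sum.elim c c', Sum.elim D D', fun n θ i => ?_⟩
  simp [hg, hg']

theorem const_mul (r : ℝ) (h : IsDiagSum g) : IsDiagSum fun n θ i => r * g n θ i := by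
  obtain ⟨T, _, c, D, hg⟩ := h
  refine ⟨T, inferInstance, fun t => r * c t, D, fun n θ i => ?_⟩
  simp [hg, Finset.mul_sum, mul_assoc]

theorem one : IsDiagSum fun (n : ℕ) (_ : Param L d n → ℝ) (_ : Fin n) => (1 : ℝ) :=
  ⟨Unit, inferInstance, fun _ => 1, fun _ => RDiag.one L d, by simp [RDiag.val_one]⟩

theorem mul (h : IsDiagSum g) (h' : IsDiagSum g') :
    IsDiagSum fun n θ i => g n θ i * g' n θ i := by
  obtain ⟨T, _, c, D, hg⟩ := h
  obtain ⟨T', _, c', D', hg'⟩ := h'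
  refine ⟨T × T', inferInstance, fun t => c t.1 * c' t.2, fun t => (D t.1).mul (D' t.2),
    fun n θ i => ?_⟩
  simp only [hg, hg']
  rw [Finset.sum_mul_sum, ← Fintype.sum_prod_type']
  refine Finset.sum_congr rfl fun t _ => ?_
  rw [RDiag.val_mul]
  ring

theorem pow (h : IsDiagSum g) (k : ℕ) : IsDiagSum fun n θ i => g n θ i ^ k := by
  induction k with
  | zero => simpa using one
  | succ k ih => simpa only [pow_succ] using ih.mul h

theorem eval (h : IsDiagSum g) (p : ℝ[X]) : IsDiagSum fun n θ i => p.eval (g n θ i) := by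
  induction p using Polynomial.induction_on' with
  | add p q hp hq => simpa using hp.add hq
  | monomial k r => simpa using (h.pow k).const_mul r

theorem input (r : ℝ) (x : Fin d → ℝ) :
    IsDiagSum fun n (θ : Param L d n → ℝ) i => r * ∑ α, θ (Param.U i α) * x α := by
  refine const_mul r ⟨Fin d, inferInstance, x, fun α => RDiag.input L α, fun n θ i => ?_⟩
  simp [RDiag.val_input, mul_comm]

theorem step (ℓ : Fin L) (h : IsDiagSum g) :
    IsDiagSum fun n θ i => (√(n : ℝ))⁻¹ * ∑ j, θ (Param.W ℓ i j) * g n θ j := by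
  obtain ⟨T, _, c, D, hg⟩ := h
  refine ⟨T, inferInstance, c, fun t => (D t).step ℓ, fun n θ i => ?_⟩
  simp only [hg, RDiag.val_step, Finset.mul_sum]
  rw [Finset.sum_comm]
  refine Finset.sum_congr rfl fun t _ => Finset.sum_congr rfl fun j _ => ?_
  ring

end IsDiagSum

theorem isDiagSum_postAct (φ : Fin (L + 1) → ℝ[X]) (x : Fin d → ℝ) (ℓ : Fin (L + 1)) :
    IsDiagSum fun n (θ : Param L d n → ℝ) => postAct φ x θ ℓ := by
  induction ℓ using Fin.induction with
  | zero => exact (IsDiagSum.input _ x).eval (φ 0)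
  | succ ℓ ih => exact (ih.step ℓ).eval (φ ℓ.succ)

/-- The network function as a linear combination of completed diagrams. -/
theorem exists_net_eq (φ : Fin (L + 1) → ℝ[X]) (x : Fin d → ℝ) :
    ∃ (T : Type) (_ : Fintype T) (c : T → ℝ) (D : T → RDiag L d), ∀ n, net n φ x = fun θ =>
      ∑ t, ∑ a : Option (D t).N → Fin n,
        (c t * (√(n : ℝ))⁻¹ ^ (Fintype.card (D t).EW + 1)) * ∏ e, θ (((D t).lab e).map a) := by
  obtain ⟨T, _, c, D, h⟩ := isDiagSum_postAct φ x (Fin.last L)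
  refine ⟨T, inferInstance, c, D, fun n => funext fun θ => ?_⟩
  rw [net]
  simp only [h, Finset.mul_sum]
  rw [Finset.sum_comm]
  refine Finset.sum_congr rfl fun t _ => ?_
  rw [← (Equiv.piOptionEquivProd (β := fun _ : Option (D t).N => Fin n)).symm.sum_comp,
    Fintype.sum_prod_type]
  refine Finset.sum_congr rfl fun i _ => ?_
  simp only [RDiag.val, Finset.mul_sum, RDiag.prod_lab]
  refine Finset.sum_congr rfl fun a _ => ?_
  have : (fun o : Option (D t).N => o.elim i a) =
      (Equiv.piOptionEquivProd (β := fun _ : Option (D t).N => Fin n)).symm (i, a) := by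
    funext o; cases o <;> rfl
  rw [this]
  have h0 : (Equiv.piOptionEquivProd (β := fun _ : Option (D t).N => Fin n)).symm (i, a) none = i :=
    rfl
  rw [h0]
  ring

end Expansion

/-! ### Derivative tensors of monomials. -/

section Derivative

open Finset

variable {V E : Type} [Fintype V] [DecidableEq V] [Fintype E] [DecidableEq E]

/-- The monomial is a multilinear product, one slot per factor, composed with a linear map selecting
coordinates. Differentiating chooses a distinct factor for each derivative, so the Leibniz rule is
correct even when `p` repeats a variable. -/
theorem derivTensor_prod_coord (p : E → V) {k : ℕ} (μ : Fin k → V) (θ : V → ℝ) :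
    derivTensor (fun θ => ∏ e, θ (p e)) μ θ =
      ∑ σ : Fin k ↪ E, if ∀ j, μ j = p (σ j) then ∏ e ∈ (univ.map σ)ᶜ, θ (p e) else 0 := by
  let f := ContinuousMultilinearMap.mkPiAlgebra ℝ E ℝ
  let g : (V → ℝ) →L[ℝ] (E → ℝ) := ContinuousLinearMap.pi fun e => ContinuousLinearMap.proj (p e)
  have hfg : (fun θ : V → ℝ => ∏ e, θ (p e)) = f ∘ g := by
    funext θ; simp [f, g]
  rw [derivTensor, hfg, ContinuousLinearMap.iteratedFDeriv_comp_right g f.contDiff θ le_top,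
    f.iteratedFDeriv_eq]
  simp only [ContinuousMultilinearMap.compContinuousLinearMap_apply,
    ContinuousMultilinearMap.iteratedFDeriv, _root_.sum_apply,
    ContinuousMultilinearMap.iteratedFDerivComponent_apply]
  refine sum_congr rfl fun σ _ => ?_
  simp only [f, g, ContinuousMultilinearMap.mkPiAlgebra_apply]
  rw [← prod_mul_prod_compl (univ.map σ), prod_map]
  trans (∏ j, if μ j = p (σ j) then (1 : ℝ) else 0) * ∏ e ∈ (univ.map σ)ᶜ, θ (p e)
  · congr 1
    · refine prod_congr rfl fun j _ => ?_
      have h2 : ∀ h, (@Function.Embedding.toEquivRange _ _ _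
          (fun _ _ => Classical.propDecidable _) σ).symm ⟨σ j, h⟩ = j := fun h => by
        rw [Equiv.symm_apply_eq]; rfl
      rw [dif_pos ⟨j, rfl⟩, h2]
      simp [Pi.single_apply, eq_comm]
    · refine prod_congr rfl fun e he => ?_
      rw [dif_neg]
      · rfl
      · rintro ⟨j, rfl⟩
        simp at he
  · rw [prod_ite_zero]
    simp

theorem derivTensor_sum {S : Type} [Fintype S] (r : S → ℝ) (p : S → (V → ℝ) → ℝ)
    (hp : ∀ s, ContDiff ℝ ⊤ (p s)) {k : ℕ} (μ : Fin k → V) (θ : V → ℝ) :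
    derivTensor (fun θ => ∑ s, r s * p s θ) μ θ = ∑ s, r s * derivTensor (p s) μ θ := by
  have hp' : ∀ s, ContDiffAt ℝ k (p s) θ := fun s => ((hp s).of_le le_top).contDiffAt
  simp only [derivTensor]
  rw [iteratedFDeriv_fun_sum_apply (fun s _ => contDiffAt_const.mul (hp' s))]
  rw [_root_.sum_apply]
  refine sum_congr rfl fun s _ => ?_
  have := iteratedFDeriv_const_smul_apply' (a := r s) (hp' s)
  simp only [smul_eq_mul] at this
  rw [this]
  simp

end Derivative

/-! ### Contracted tensor products as amplitudes. -/

section TensorProduct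

open Finset Classical

variable {L d m : ℕ}

/-- The factors hit by the derivatives, arranged in contracted pairs. -/
def Contraction.emb (c : Contraction m) {E : Fin m → Type} (σ : ∀ I, Fin (c.rank I) ↪ E I) :
    Fin c.pairs × Fin 2 ↪ Σ I, E I :=
  c.slot.symm.toEmbedding.trans (Function.Embedding.sigmaMap (.refl _) σ)

theorem Contraction.emb_slot (c : Contraction m) {E : Fin m → Type}
    (σ : ∀ I, Fin (c.rank I) ↪ E I) (I : Fin m) (j : Fin (c.rank I)) :
    c.emb σ (c.slot ⟨I, j⟩) = ⟨I, σ I j⟩ := by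
  simp only [Contraction.emb, Function.Embedding.trans_apply, Equiv.coe_toEmbedding,
    Equiv.symm_apply_apply]
  rfl

/-- Summing over the tensor indices `ν` only imposes a condition: the factors hit determine `ν`, so
one value contributes if the labels agree within each contracted pair, and none otherwise. -/
theorem sum_prod_eq_amp (c : Contraction m) (D : Fin m → RDiag L d)
    (σ : ∀ I, Fin (c.rank I) ↪ (D I).E) (n : ℕ) (θ : Param L d n → ℝ) :
    ∑ ν : Fin c.pairs → Param L d n, ∏ I, ∑ a : Option (D I).N → Fin n,
      (if ∀ j, ν (c.slot ⟨I, j⟩).1 = ((D I).lab (σ I j)).map a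
        then ∏ e ∈ (univ.map (σ I))ᶜ, θ (((D I).lab e).map a) else 0) =
      (RDiag.family D).amp (c.emb σ) n θ := by
  have hrest : rest (c.emb σ) = univ.sigma fun I => (univ.map (σ I))ᶜ := by
    ext ⟨I, e⟩
    simp only [mem_rest, mem_sigma, mem_univ, true_and, mem_compl, Finset.mem_map, not_exists]
    constructor
    · intro h j hj
      exact h (c.slot ⟨I, j⟩) (by rw [c.emb_slot, hj])
    · intro h x hx
      obtain ⟨⟨J, j⟩, rfl⟩ := c.slot.surjective x
      rw [c.emb_slot] at hx
      obtain ⟨rfl, hx⟩ := Sigma.mk.inj_iff.1 hx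
      exact h j (eq_of_heq hx)
  simp only [prod_univ_sum, Fintype.piFinset_univ]
  rw [sum_comm]
  unfold Diag.amp
  let ε : (∀ I, Option (D I).N → Fin n) ≃ ((RDiag.family D).A → Fin n) :=
    (Equiv.piCurry fun (I : Fin m) (_ : Option (D I).N) => Fin n).symm
  refine Fintype.sum_equiv ε _ _ fun a => ?_
  set b : (RDiag.family D).A → Fin n := ε a with hb
  have hpar : ∀ I e, (RDiag.family D).par b ⟨I, e⟩ = ((D I).lab e).map (a I) := by
    intro I e
    exact PIdx.map_map (C := Fin n) b (Sigma.mk I) ((D I).lab e)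
  have hcond : ∀ ν : Fin c.pairs → Param L d n,
      (∀ I ∈ (univ : Finset (Fin m)), ∀ j, ν (c.slot ⟨I, j⟩).1 = ((D I).lab (σ I j)).map (a I)) ↔
        ∀ x, ν x.1 = (RDiag.family D).par b (c.emb σ x) := by
    intro ν
    constructor
    · intro h x
      obtain ⟨⟨J, j⟩, rfl⟩ := c.slot.surjective x
      rw [h J (mem_univ _) j, ← hpar, c.emb_slot]
    · intro h I _ j
      rw [h, ← hpar, c.emb_slot]
  simp only [prod_ite_zero, hcond]
  have hprod : ∏ I, ∏ e ∈ (univ.map (σ I))ᶜ, θ (((D I).lab e).map (a I)) =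
      ∏ e ∈ rest (c.emb σ), θ ((RDiag.family D).par b e) := by
    rw [hrest, prod_sigma]
    simp only [hpar]
  rw [hprod]
  unfold Diag.ampTerm Diag.Contracts
  split_ifs with h
  · have : ∀ ν : Fin c.pairs → Param L d n,
        (∀ x, ν x.1 = (RDiag.family D).par b (c.emb σ x)) ↔
          ν = fun p => (RDiag.family D).par b (c.emb σ (p, 0)) := by
      intro ν
      constructor
      · exact fun hν => funext fun p => hν (p, 0)
      · rintro rfl ⟨p, i⟩
        fin_cases i
        · rfl
        · exact h p
    simp only [this, sum_ite_eq', mem_univ, if_true]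
    rfl
  · refine sum_eq_zero fun ν _ => if_neg fun hν => h fun p => ?_
    exact (hν (p, 0)).symm.trans (hν (p, 1))

/-- A product of derivative tensors is a linear combination of amplitudes. -/
theorem exists_tensorProd_eq (c : Contraction m) (φ : Fin (L + 1) → ℝ[X]) (x : Fin m → Fin d → ℝ) :
    ∃ (T : Type) (_ : Fintype T) (r : T → ℝ) (D : T → Diag L d (Fin m))
      (δ : ∀ t, Fin c.pairs × Fin 2 ↪ (D t).E),
      (∀ t y, (D t).own (δ t y) = (c.slot.symm y).1) ∧
      ∀ n θ, c.tensorProd n φ x θ =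
        ∑ t, r t * (√(n : ℝ))⁻¹ ^ ((D t).numW + m) * (D t).amp (δ t) n θ := by
  choose T₀ _ r₀ D₀ h₀ using fun I => exists_net_eq φ (x I)
  refine ⟨∀ I, Σ t : T₀ I, (Fin (c.rank I) ↪ (D₀ I t).E), inferInstance,
    fun t => ∏ I, r₀ I (t I).1, fun t => RDiag.family fun I => D₀ I (t I).1,
    fun t => c.emb fun I => (t I).2, fun t y => rfl, fun n θ => ?_⟩
  have hd : ∀ (ν : Fin c.pairs → Param L d n) (I : Fin m),
      derivTensor (net n φ (x I)) (fun a => ν (c.slot ⟨I, a⟩).1) θ =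
      ∑ k : Σ t : T₀ I, (Fin (c.rank I) ↪ (D₀ I t).E),
        (r₀ I k.1 * (√(n : ℝ))⁻¹ ^ (Fintype.card (D₀ I k.1).EW + 1)) *
          ∑ a : Option (D₀ I k.1).N → Fin n,
            (if ∀ j, ν (c.slot ⟨I, j⟩).1 = ((D₀ I k.1).lab (k.2 j)).map a
              then ∏ e ∈ (univ.map k.2)ᶜ, θ (((D₀ I k.1).lab e).map a) else 0) := by
    intro ν I
    have hnet : net n φ (x I) = fun θ =>
        ∑ s : Σ t : T₀ I, (Option (D₀ I t).N → Fin n),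
          (r₀ I s.1 * (√(n : ℝ))⁻¹ ^ (Fintype.card (D₀ I s.1).EW + 1)) *
            ∏ e, θ (((D₀ I s.1).lab e).map s.2) := by
      rw [h₀ I n]
      funext θ
      rw [Fintype.sum_sigma]
    rw [hnet, derivTensor_sum _ (fun (s : Σ t : T₀ I, (Option (D₀ I t).N → Fin n)) (θ : Param L d n → ℝ) =>
        ∏ e, θ (((D₀ I s.1).lab e).map s.2))
      (fun s => contDiff_prod fun e _ => contDiff_apply ℝ ℝ _)]
    simp only [derivTensor_prod_coord]
    rw [Fintype.sum_sigma, Fintype.sum_sigma]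
    refine sum_congr rfl fun t _ => ?_
    simp only [mul_sum]
    exact Finset.sum_comm (s := univ) (t := univ)
      (f := fun (a : Option (D₀ I t).N → Fin n) (σ : Fin (c.rank I) ↪ (D₀ I t).E) =>
        (r₀ I t * (√(n : ℝ))⁻¹ ^ (Fintype.card (D₀ I t).EW + 1)) *
          (if ∀ j, ν (c.slot ⟨I, j⟩).1 = ((D₀ I t).lab (σ j)).map a
            then ∏ e ∈ (univ.map σ)ᶜ, θ (((D₀ I t).lab e).map a) else 0))
  simp only [Contraction.tensorProd, hd, prod_univ_sum, Fintype.piFinset_univ]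
  rw [sum_comm]
  refine sum_congr rfl fun k _ => ?_
  simp only [prod_mul_distrib]
  rw [← mul_sum, sum_prod_eq_amp c (fun I => D₀ I (k I).1) (fun I => (k I).2) n θ,
    prod_pow_eq_pow_sum, sum_add_distrib, RDiag.numW_family]
  simp

end TensorProduct

/-! ### The cluster graph and the number of components. -/

section Clusters

open Finset Classical

variable {L d m : ℕ}

namespace Contraction

/-- A function that takes equal values on contracted tensors factors through the clusters. -/
theorem exists_factor (c : Contraction m) {R : Type} (ρ : Fin m → R)
    (h : ∀ p, ρ (c.slot.symm (p, 0)).1 = ρ (c.slot.symm (p, 1)).1) :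
    ∃ ρ' : c.clusterGraph.ConnectedComponent → R,
      ∀ I, ρ' (c.clusterGraph.connectedComponentMk I) = ρ I := by
  have key : ∀ I J a b, (c.slot ⟨I, a⟩).1 = (c.slot ⟨J, b⟩).1 → ρ I = ρ J := by
    intro I J a b hab
    have h1 : ∀ y : Fin c.pairs × Fin 2,
        ρ (c.slot.symm y).1 = ρ (c.slot.symm (y.1, 0)).1 := by
      rintro ⟨p, i⟩
      fin_cases i
      · rfl
      · exact (h p).symm
    have h2 := h1 (c.slot ⟨I, a⟩)
    have h3 := h1 (c.slot ⟨J, b⟩)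
    rw [Equiv.symm_apply_apply] at h2 h3
    rw [hab] at h2
    exact h2.trans h3.symm
  have hadj : ∀ I J, c.clusterGraph.Adj I J → ρ I = ρ J := by
    rintro I J ⟨-, ⟨a, b, hab⟩ | ⟨a, b, hab⟩⟩
    · exact key _ _ _ _ hab
    · exact (key _ _ _ _ hab).symm
  have hwalk : ∀ I J, c.clusterGraph.Walk I J → ρ I = ρ J := by
    intro I J w
    induction w with
    | nil => rfl
    | cons hIJ _ ih => exact (hadj _ _ hIJ).trans ih
  exact ⟨SimpleGraph.ConnectedComponent.lift ρ fun I J w _ => hwalk I J w, fun I => rfl⟩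

theorem supp_ncard (c : Contraction m) (K : c.clusterGraph.ConnectedComponent) :
    K.supp.ncard = #{I | c.clusterGraph.connectedComponentMk I = K} := by
  rw [Set.ncard_eq_toFinset_card']
  congr 1
  ext I
  simp

theorem numEven_eq (c : Contraction m) :
    c.numEven = #{K | Even #{I | c.clusterGraph.connectedComponentMk I = K}} := by
  rw [numEven, Set.ncard_eq_toFinset_card']
  congr 1
  ext K
  simp [supp_ncard]

theorem numOdd_eq (c : Contraction m) :
    c.numOdd = #{K | ¬ Even #{I | c.clusterGraph.connectedComponentMk I = K}} := by
  rw [numOdd, Set.ncard_eq_toFinset_card']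
  congr 1
  ext K
  simp [supp_ncard]

theorem sum_cluster_weight (c : Contraction m) :
    (∑ K, if Even #{I | c.clusterGraph.connectedComponentMk I = K} then 2 else 1) =
      2 * c.numEven + c.numOdd := by
  rw [sum_ite, sum_const, sum_const, numEven_eq, numOdd_eq]
  simp [mul_comm]

theorem card_clusters (c : Contraction m) :
    Nat.card c.clusterGraph.ConnectedComponent = c.numEven + c.numOdd := by
  rw [Nat.card_eq_fintype_card, numEven_eq, numOdd_eq, card_filter_add_card_filter_not, card_univ]

/-- The pairing contains the contractions, so `ρ` is constant on clusters, and the blocks of `ρ` are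
even unions of clusters. -/
theorem componentBound (c : Contraction m) (D : Diag L d (Fin m))
    (δ : Fin c.pairs × Fin 2 ↪ D.E) (hδ : ∀ y, D.own (δ y) = (c.slot.symm y).1)
    (P : Equiv.Perm D.E) (hP : IsPairing δ P) :
    D.ComponentBound P (2 * c.numEven + c.numOdd) := by
  intro R _ ρ hsurj hown heven
  obtain ⟨ρ', hρ'⟩ := c.exists_factor ρ fun p => by
    rw [← hδ, ← hδ, ← hP.2.2 p, hown]
  rw [← sum_cluster_weight]
  exact two_mul_card_le_sum c.clusterGraph.connectedComponentMk ρ'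
    (by intro r; obtain ⟨I, rfl⟩ := hsurj r; exact ⟨I, hρ' I⟩) (by simpa [hρ'] using heven)

theorem exists_factor_double (c : Contraction m) (D : Diag L d (Fin m))
    (δ : Fin c.pairs × Fin 2 ↪ D.E) (hδ : ∀ y, D.own (δ y) = (c.slot.symm y).1)
    (P : Equiv.Perm (D.E ⊕ D.E)) (hP : IsPairing (Diag.doubleEmb δ) P)
    {R : Type} (ρ : Fin m ⊕ Fin m → R)
    (hown : ∀ e, ρ (D.double.own (P e)) = ρ (D.double.own e)) :
    ∃ ρ' : c.clusterGraph.ConnectedComponent ⊕ c.clusterGraph.ConnectedComponent → R,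
      ∀ I, ρ' (Sum.map c.clusterGraph.connectedComponentMk
        c.clusterGraph.connectedComponentMk I) = ρ I := by
  obtain ⟨ρ₁, h₁⟩ := c.exists_factor (ρ ∘ Sum.inl) fun p => by
    have h2 := hP.2.2 (Sum.inl p)
    have h3 := hown (Sum.inl (δ (p, 0)))
    rw [← hδ, ← hδ]
    exact h3.symm.trans (congrArg (ρ ∘ D.double.own) h2)
  obtain ⟨ρ₂, h₂⟩ := c.exists_factor (ρ ∘ Sum.inr) fun p => by
    have h2 := hP.2.2 (Sum.inr p)
    have h3 := hown (Sum.inr (δ (p, 0)))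
    rw [← hδ, ← hδ]
    exact h3.symm.trans (congrArg (ρ ∘ D.double.own) h2)
  exact ⟨Sum.elim ρ₁ ρ₂, by rintro (I | I) <;> simp [h₁, h₂]⟩

theorem componentBound_double (c : Contraction m) (D : Diag L d (Fin m))
    (δ : Fin c.pairs × Fin 2 ↪ D.E) (hδ : ∀ y, D.own (δ y) = (c.slot.symm y).1)
    (P : Equiv.Perm (D.E ⊕ D.E))
    (hP : IsPairing (Diag.doubleEmb δ) P) :
    D.double.ComponentBound P (2 * (2 * c.numEven + c.numOdd)) := by
  intro R _ ρ hsurj hown heven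
  obtain ⟨ρ', hρ'⟩ := c.exists_factor_double D δ hδ P hP ρ hown
  refine (two_mul_card_le_sum (Sum.map c.clusterGraph.connectedComponentMk
    c.clusterGraph.connectedComponentMk) ρ'
    (by intro r; obtain ⟨I, rfl⟩ := hsurj r; exact ⟨I, hρ' I⟩)
    (by simpa only [hρ'] using heven)).trans (le_of_eq ?_)
  rw [Fintype.sum_sum_type, ← sum_cluster_weight, two_mul]
  congr 1
  · refine sum_congr rfl fun K _ => ?_
    have : #{I : Fin m ⊕ Fin m | Sum.map c.clusterGraph.connectedComponentMk
        c.clusterGraph.connectedComponentMk I = Sum.inl K} =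
        #{I | c.clusterGraph.connectedComponentMk I = K} := by
      rw [card_filter, card_filter, Fintype.sum_sum_type]
      simp
    rw [this]
  · refine sum_congr rfl fun K _ => ?_
    have : #{I : Fin m ⊕ Fin m | Sum.map c.clusterGraph.connectedComponentMk
        c.clusterGraph.connectedComponentMk I = Sum.inr K} =
        #{I | c.clusterGraph.connectedComponentMk I = K} := by
      rw [card_filter, card_filter, Fintype.sum_sum_type]
      simp
    rw [this]

theorem componentBound_double_of_cross (c : Contraction m) (D : Diag L d (Fin m))
    (δ : Fin c.pairs × Fin 2 ↪ D.E) (hδ : ∀ y, D.own (δ y) = (c.slot.symm y).1)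
    (h0 : c.numOdd = 0) (P : Equiv.Perm (D.E ⊕ D.E))
    (hP : IsPairing (Diag.doubleEmb δ) P) (hcross : ∃ e e', P (Sum.inl e) = Sum.inr e') :
    D.double.ComponentBound P (4 * c.numEven - 2) := by
  intro R _ ρ hsurj hown heven
  obtain ⟨ρ', hρ'⟩ := c.exists_factor_double D δ hδ P hP ρ hown
  have hsurj' : Function.Surjective ρ' := by
    intro r
    obtain ⟨I, rfl⟩ := hsurj r
    exact ⟨_, hρ' I⟩
  -- The crossing pair gives two clusters from different copies the same image, so the surjection
  -- from the clusters of both copies is not injective.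
  have hlt : Fintype.card R < Fintype.card
      (c.clusterGraph.ConnectedComponent ⊕ c.clusterGraph.ConnectedComponent) := by
    refine Fintype.card_lt_of_surjective_not_injective ρ' hsurj' fun hinj => ?_
    obtain ⟨e, e', he⟩ := hcross
    have h1 : ρ (Sum.inr (D.own e')) = ρ (Sum.inl (D.own e)) :=
      (congrArg (ρ ∘ D.double.own) he).symm.trans (hown (Sum.inl e))
    rw [← hρ', ← hρ'] at h1
    exact absurd (hinj h1) (by simp)
  rw [← Nat.card_eq_fintype_card, ← Nat.card_eq_fintype_card, Nat.card_sum, card_clusters, h0,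
    Nat.card_eq_fintype_card] at hlt
  omega

end Contraction

end Clusters

/-! ### Powers of the width and the final bounds. -/

section Asymptotics

variable {L d m : ℕ}

instance (L d n : ℕ) : IsProbabilityMeasure (initLaw L d n) :=
  inferInstanceAs (IsProbabilityMeasure (Measure.pi _))

/-- Cauchy–Schwarz applied pointwise to the centred variables; no control of the covariances between
different amplitudes is needed. -/
theorem variance_sum_le {Ω T : Type*} [MeasurableSpace Ω] {μ : Measure Ω} [IsProbabilityMeasure μ]
    [Fintype T] (X : T → Ω → ℝ) (hX : ∀ t, MemLp (X t) 2 μ) :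
    variance (fun ω => ∑ t, X t ω) μ ≤ Fintype.card T * ∑ t, variance (X t) μ := by
  have hS : MemLp (fun ω => ∑ t, X t ω) 2 μ := memLp_finsetSum _ fun t _ => hX t
  have hint : ∀ t, Integrable (X t) μ := fun t => (hX t).integrable one_le_two
  have hsq : ∀ t, Integrable (fun ω => (X t ω - ∫ ω, X t ω ∂μ) ^ 2) μ := fun t =>
    ((hX t).sub (memLp_const _)).integrable_sq
  rw [variance_eq_integral hS.aestronglyMeasurable.aemeasurable]
  have h1 : ∀ t, variance (X t) μ = ∫ ω, (X t ω - ∫ ω, X t ω ∂μ) ^ 2 ∂μ := fun t =>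
    variance_eq_integral (hX t).aestronglyMeasurable.aemeasurable
  simp only [h1]
  rw [integral_finsetSum _ fun t _ => hint t, ← integral_finsetSum _ fun t _ => hsq t,
    ← integral_const_mul]
  refine integral_mono ?_ ((integrable_finsetSum _ fun t _ => hsq t).const_mul _) fun ω => ?_
  · exact (hS.sub (memLp_const _)).integrable_sq
  · simp only [← Finset.sum_sub_distrib]
    exact sq_sum_le_card_mul_sum_sq

/-- The hidden weights cancel: their normalization offsets exactly the `w/2` edges in the count. -/
theorem inv_sqrt_pow_mul {n : ℕ} (hn : 1 ≤ n) (w m b : ℕ) :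
    (√(n : ℝ))⁻¹ ^ (w + m) * √(n : ℝ) ^ (w + b) = (n : ℝ) ^ (((b : ℝ) - m) / 2) := by
  have hn0 : (0 : ℝ) < n := by exact_mod_cast hn
  have hs : 0 < √(n : ℝ) := Real.sqrt_pos.2 hn0
  have h : (√(n : ℝ))⁻¹ ^ (w + m) * √(n : ℝ) ^ (w + b) =
      √(n : ℝ) ^ b / √(n : ℝ) ^ m := by
    rw [inv_pow, pow_add, pow_add]
    field_simp
  rw [h, Real.sqrt_eq_rpow, ← Real.rpow_mul_natCast hn0.le, ← Real.rpow_mul_natCast hn0.le,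
    ← Real.rpow_sub hn0]
  congr 1
  ring

theorem Contraction.tensorProd_memLp (c : Contraction m) (φ : Fin (L + 1) → ℝ[X])
    (x : Fin m → Fin d → ℝ) (n : ℕ) : MemLp (c.tensorProd n φ x) 2 (initLaw L d n) := by
  obtain ⟨T, _, r, D, δ, -, h⟩ := exists_tensorProd_eq c φ x
  rw [funext (h n)]
  exact memLp_finsetSum _ fun t _ => ((D t).memLp_amp (δ t) n).const_mul _

theorem Contraction.correlation_isBigO (c : Contraction m) (φ : Fin (L + 1) → ℝ[X])
    (x : Fin m → Fin d → ℝ) :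
    (fun n : ℕ => c.correlation n φ x) =O[atTop] fun n : ℕ => (n : ℝ) ^ c.sC := by
  obtain ⟨T, _, r, D, δ, hδ, h⟩ := exists_tensorProd_eq c φ x
  choose C hC using fun t => (D t).abs_integral_amp_le (δ t) _
    (c.componentBound (D t) (δ t) (hδ t))
  refine IsBigO.of_bound (∑ t, |r t| * C t) ?_
  filter_upwards [eventually_ge_atTop 1] with n hn
  have hs : c.sC = (((2 * c.numEven + c.numOdd : ℕ) : ℝ) - m) / 2 := by
    rw [Contraction.sC]; push_cast; ring
  rw [Real.norm_of_nonneg (Real.rpow_nonneg (Nat.cast_nonneg n) _), Real.norm_eq_abs,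
    Contraction.correlation, hs]
  simp only [h n]
  rw [integral_finsetSum _ fun t _ =>
    (((D t).memLp_amp (δ t) n).integrable one_le_two).const_mul _, Finset.sum_mul]
  refine (Finset.abs_sum_le_sum_abs _ _).trans (Finset.sum_le_sum fun t _ => ?_)
  rw [integral_const_mul, abs_mul, abs_mul,
    abs_of_nonneg (a := (√(n : ℝ))⁻¹ ^ ((D t).numW + m)) (by positivity),
    ← inv_sqrt_pow_mul hn (D t).numW]
  calc |r t| * (√(n : ℝ))⁻¹ ^ ((D t).numW + m) * |∫ θ, (D t).amp (δ t) n θ ∂(initLaw L d n)|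
      ≤ |r t| * (√(n : ℝ))⁻¹ ^ ((D t).numW + m) *
        (C t * √(n : ℝ) ^ ((D t).numW + (2 * c.numEven + c.numOdd))) :=
        mul_le_mul_of_nonneg_left (hC t n hn) (by positivity)
    _ = _ := by ring

/-- Squaring the prefactor doubles both `numW` and `m`, matching the `2 * numW` hidden weights of
the doubled diagram and leaving the exponent `(b - 2m)/2`. -/
theorem variance_isBigO_of_componentBound (c : Contraction m) (φ : Fin (L + 1) → ℝ[X])
    (x : Fin m → Fin d → ℝ) (b : ℕ)
    (hb : ∀ (D : Diag L d (Fin m)) (δ : Fin c.pairs × Fin 2 ↪ D.E),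
      (∀ y, D.own (δ y) = (c.slot.symm y).1) → ∀ P : Equiv.Perm (D.E ⊕ D.E),
        IsPairing (Diag.doubleEmb δ) P → (∃ e e', P (Sum.inl e) = Sum.inr e') →
          D.double.ComponentBound P b) :
    (fun n : ℕ => variance (c.tensorProd n φ x) (initLaw L d n)) =O[atTop]
      fun n : ℕ => (n : ℝ) ^ (((b : ℝ) - (2 * m : ℕ)) / 2) := by
  obtain ⟨T, _, r, D, δ, hδ, h⟩ := exists_tensorProd_eq c φ x
  choose C hC using fun t => (D t).abs_variance_amp_le (δ t) b (hb (D t) (δ t) (hδ t))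
  refine IsBigO.of_bound (Fintype.card T * ∑ t, r t ^ 2 * C t) ?_
  filter_upwards [eventually_ge_atTop 1] with n hn
  rw [Real.norm_of_nonneg (Real.rpow_nonneg (Nat.cast_nonneg n) _),
    Real.norm_of_nonneg (variance_nonneg _ _), funext (h n), mul_assoc, Finset.sum_mul]
  refine (variance_sum_le _ fun t => ((D t).memLp_amp (δ t) n).const_mul _).trans
    (mul_le_mul_of_nonneg_left (Finset.sum_le_sum fun t _ => ?_) (Nat.cast_nonneg _))
  rw [variance_const_mul, ← inv_sqrt_pow_mul hn (2 * (D t).numW)]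
  calc (r t * (√(n : ℝ))⁻¹ ^ ((D t).numW + m)) ^ 2 *
        variance ((D t).amp (δ t) n) (initLaw L d n)
      ≤ (r t * (√(n : ℝ))⁻¹ ^ ((D t).numW + m)) ^ 2 *
        (C t * √(n : ℝ) ^ (2 * (D t).numW + b)) :=
        mul_le_mul_of_nonneg_left (hC t n hn) (by positivity)
    _ = _ := by rw [mul_pow, ← pow_mul]; ring_nf

theorem Contraction.variance_isBigO (c : Contraction m) (φ : Fin (L + 1) → ℝ[X])
    (x : Fin m → Fin d → ℝ) :
    (fun n : ℕ => variance (c.tensorProd n φ x) (initLaw L d n)) =O[atTop]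
      fun n : ℕ => (n : ℝ) ^ c.sV := by
  by_cases h0 : c.numOdd = 0
  -- For `m = 0` there is no cluster to lose, and `4 * numEven - 2` would truncate to zero; but the
  -- tensor product is then constant and its variance vanishes. For `m > 0` some cluster exists,
  -- necessarily even, and the natural subtraction is exact.
  · rcases Nat.eq_zero_or_pos m with rfl | hm
    · have : ∀ n : ℕ, variance (c.tensorProd n φ x) (initLaw L d n) = 0 := by
        intro n
        have hF : c.tensorProd n φ x =
            fun _ => ∑ _μ : Fin c.pairs → Param L d n, (1 : ℝ) := by
          funext θ
          simp [Contraction.tensorProd]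
        rw [hF, variance_eq_sub (memLp_const _)]
        simp [sq]
      simp only [this]
      exact isBigO_zero _ _
    · have hpos : 0 < c.numEven + c.numOdd := by
        rw [← c.card_clusters]
        exact Nat.card_pos_iff.2
          ⟨⟨c.clusterGraph.connectedComponentMk ⟨0, hm⟩⟩, inferInstance⟩
      have hs : c.sV = (((4 * c.numEven - 2 : ℕ) : ℝ) - (2 * m : ℕ)) / 2 := by
        rw [Contraction.sV, if_pos h0, Contraction.sC, h0, Nat.cast_sub (by omega)]
        push_cast
        ring
      rw [hs]
      exact variance_isBigO_of_componentBound c φ x _ fun D δ hδ P hP hcross =>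
        c.componentBound_double_of_cross D δ hδ h0 P hP hcross
  · have hs : c.sV = (((2 * (2 * c.numEven + c.numOdd) : ℕ) : ℝ) - (2 * m : ℕ)) / 2 := by
      rw [Contraction.sV, if_neg h0, Contraction.sC]
      push_cast
      ring
    rw [hs]
    exact variance_isBigO_of_componentBound c φ x _ fun D δ hδ P hP _ =>
      c.componentBound_double D δ hδ P hP

end Asymptotics

end WideNet

theorem mainTheorem3 {L d m : ℕ} (φ : Fin (L + 1) → ℝ[X]) (c : WideNet.Contraction m)
    (x : Fin m → Fin d → ℝ) :
    (∀ n : ℕ, MemLp (c.tensorProd n φ x) 2 (WideNet.initLaw L d n)) ∧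
    (fun n : ℕ => c.correlation n φ x) =O[atTop] (fun n : ℕ => (n : ℝ) ^ c.sC) ∧
    (fun n : ℕ => variance (c.tensorProd n φ x) (WideNet.initLaw L d n))
      =O[atTop] (fun n : ℕ => (n : ℝ) ^ c.sV) ∧
    (c.numOdd = 0 →
      (fun n : ℕ => (n : ℝ) ^ c.sV) =o[atTop] (fun n : ℕ => (n : ℝ) ^ (2 * c.sC))) := by
  refine ⟨c.tensorProd_memLp φ x, c.correlation_isBigO φ x, c.variance_isBigO φ x, fun h0 => ?_⟩
  have hlt : c.sV < 2 * c.sC := by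
    rw [WideNet.Contraction.sV, if_pos h0]
    linarith
  refine (isLittleO_of_tendsto' ?_ ?_ : (fun y : ℝ => y ^ c.sV) =o[atTop]
    fun y => y ^ (2 * c.sC)).comp_tendsto tendsto_natCast_atTop_atTop
  · filter_upwards [eventually_gt_atTop 0] with y hy h
    exact absurd h (Real.rpow_pos_of_pos hy _).ne'
  -- The quotient of the two powers is `y ^ (-(2 s_C - s_V))`, with `2 s_C - s_V > 0`.
  · refine (tendsto_rpow_neg_atTop (sub_pos.2 hlt)).congr' ?_
    filter_upwards [eventually_gt_atTop 0] with y hy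
    rw [← Real.rpow_sub hy, neg_sub]
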